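/- Let $\mathcal X$ be a Euclidean space (a finite-dimensional real inner product space), let $G=(Q,E)$ be a connected undirected graph without self loops on a finite set $Q$ of $|Q|>1$ agents, and write $n\sim m$ if $\{n,m\}\in E$. For $n\in Q$ let $f_n:\mathcal X\to\mathbb R$ be convex and differentiable with $1/\beta$-Lipschitz gradient, where $\beta>0$, and let $g_n:\mathcal X\to(-\infty,+\infty]$ be proper, lower semicontinuous and convex. Assume that the infimum of $$\inf_{x\in\mathcal X}\ \sum_{n\in Q}\bigl(f_n(x)+g_n(x)\bigr)\qquad (4.1)$$ is attained and that $\bigcap_{n\in Q}\operatorname{ri}\operatorname{dom} g_n\neq\emptyset$. Let $D:\mathcal X^{Q}\to\prod_{\varepsilon\in E}\mathcal X^2$ be the linear operator $Dx=\bigl((x_n,x_m)\bigr)_{\{n,m\}\in E}$, and write $v_{\varepsilon}(n),v_\varepsilon(m)$ for the two components of $v\in\prod_{\varepsilon\in E}\mathcal X^2$ at the edge $\varepsilon=\{n,m\}$, so that $(D^Tv)_n=\sum_{m\sim n}v_{\{n,m\}}(n)$. Let $0<\gamma<2\beta$ and $0<\lambda\le 1/(\lambda_{\max}(DD^T)+1)$,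 where $\lambda_{\max}$ denotes the largest eigenvalue. For a function $\varphi$ put $\operatorname{prox}_\varphi(x)=\arg\min_z\bigl(\varphi(z)+\tfrac12\|x-z\|^2\bigr)$. Let $(\zeta^k)_{k\ge1}$ be i.i.d. random subsets of $Q$ such that the union of all sets $B\subseteq Q$ with $\mathbb P[\zeta^1=B]>0$ is $Q$. The algorithm DASPDFP$^2$O starts from an arbitrary deterministic $(v^0,y^0,x^0)\in\prod_{\varepsilon\in E}\mathcal X^2\times\mathcal X^Q\times\mathcal X^Q$. At step $k\ge 0$ put $p_n^k=x_n^k-\gamma\nabla f_n(x_n^k)$ and $a_n^k=p_n^k-\lambda y_n^k-\lambda (D^Tv^k)_n$. Every active agent $n\in\zeta^{k+1}$ sets $$v^{k+1}_{\{n,m\}}(n)=\frac{a_n^k-a_m^k}{2}+\frac{v^k_{\{n,m\}}(n)-v^k_{\{n,m\}}(m)}{2}\quad\text{for all } m\sim n,$$ $$y_n^{k+1}=\bigl(I-\operatorname{prox}_{\frac{\gamma}{\lambda}g_n}\bigr)\bigl(p_n^k+(1-\lambda)y_n^k-\lambda (D^Tv^k)_n\bigr),$$ $$x_n^{k+1}=p_n^k-\lambda\sum_{m\sim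 n}v^{k+1}_{\{n,m\}}(n)-\lambda y_n^{k+1},$$ and every agent $n\notin\zeta^{k+1}$ keeps $y_n^{k+1}=y_n^k$, $x_n^{k+1}=x_n^k$ and $v^{k+1}_{\{n,m\}}(n)=v^k_{\{n,m\}}(n)$ for all $m\sim n$. Then, almost surely, there is a solution $x^\star$ of (4.1) (depending on the realization) such that $x_n^k\to x^\star$ as $k\to\infty$ for every $n\in Q$. -/

import Mathlib

open MeasureTheory ProbabilityTheory

namespace DASPDFP

noncomputable section

variable {X : Type*} [NormedAddCommGroup X] [InnerProductSpace ℝ X]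

/-- The gradient of a real-valued function on a Euclidean (finite-dimensional inner product)
space. -/
def grad [FiniteDimensional ℝ X] (f : X → ℝ) (x : X) : X :=
  haveI : CompleteSpace X := FiniteDimensional.complete ℝ X
  gradient f x

/-- The class `Γ₀(X)` of proper lower semicontinuous convex functions `X → (-∞, +∞]`
(convexity is convexity of the epigraph). -/
structure IsGammaZero (g : X → EReal) : Prop where
  ne_bot : ∀ x, g x ≠ ⊥
  proper : ∃ x, g x ≠ ⊤
  lsc : LowerSemicontinuous g
  convex : Convex ℝ {p : X × ℝ | g p.1 ≤ (p.2 : EReal)}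

/-- The effective domain of an extended-real-valued function. -/
def effDom (g : X → EReal) : Set X := {x | g x < ⊤}

/-- The proximity operator: `prox φ x` is the minimizer of `z ↦ φ z + ‖x - z‖² / 2`, which exists
and is unique for `φ ∈ Γ₀(X)`. -/
def prox (φ : X → EReal) (x : X) : X :=
  Classical.epsilon fun p =>
    IsMinOn (fun z => φ z + ((‖x - z‖ ^ 2 / 2 : ℝ) : EReal)) Set.univ p

/-- The objective `∑ₙ (fₙ(x) + gₙ(x))`. -/
def objective {Q : Type*} [Fintype Q] (f : Q → X → ℝ) (g : Q → X → EReal) (x : X) : EReal :=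
  ∑ n, ((f n x : EReal) + g n x)

/-- `x` solves `inf_x ∑ₙ (fₙ(x) + gₙ(x))`: the infimum is attained at `x`. -/
def IsSolution {Q : Type*} [Fintype Q] (f : Q → X → ℝ) (g : Q → X → EReal) (x : X) : Prop :=
  IsMinOn (objective f g) Set.univ x

/-- The largest eigenvalue of a linear operator. -/
def lambdaMax {E : Type*} [AddCommGroup E] [Module ℝ E] (A : E →ₗ[ℝ] E) : ℝ :=
  sSup {μ : ℝ | Module.End.HasEigenvalue A μ}

variable {Q : Type*} [Fintype Q] [DecidableEq Q] (G : SimpleGraph Q) [DecidableRel G.Adj]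

/-- The operator `D x = ((xₙ, xₘ))_{{n,m} ∈ E}` from `X^Q` to `∏_{ε ∈ E} X²`, both with their
Euclidean structure. A pair (edge `ε = {n,m}`, endpoint `n`) is the dart `(n,m)`, so an element
of `∏_{ε ∈ E} X²` is a family indexed by the darts, whose value at `(n,m)` is
the component `v_{{n,m}}(n)`. -/
def edgeOp (X : Type*) [NormedAddCommGroup X] [InnerProductSpace ℝ X] :
    PiLp 2 (fun _ : Q => X) →ₗ[ℝ] PiLp 2 (fun _ : G.Dart => X) where
  toFun x := WithLp.toLp 2 fun d => x d.fst
  map_add' _ _ := rfl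
  map_smul' _ _ := rfl

/-- `D Dᵀ`. -/
def edgeGram (X : Type*) [NormedAddCommGroup X] [InnerProductSpace ℝ X] [FiniteDimensional ℝ X] :
    PiLp 2 (fun _ : G.Dart => X) →ₗ[ℝ] PiLp 2 (fun _ : G.Dart => X) :=
  edgeOp G X ∘ₗ LinearMap.adjoint (edgeOp G X)

/-- The state `u = (v, y, x)` of the network: `v (n,m)` is `v_{{n,m}}(n)`, held by agent `n`
together with `y n` and `x n`. -/
@[ext] structure State (X : Type*) where
  v : G.Dart → X
  y : Q → X
  x : Q → X

variable {G}

/-- `∑_{m ∼ n} v_{{n,m}}(n)`, the `n`-th component of `Dᵀ v`. -/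
def nodeSum (v : G.Dart → X) (n : Q) : X := ∑ d : G.Dart with d.fst = n, v d

variable [FiniteDimensional ℝ X] (f : Q → X → ℝ) (g : Q → X → EReal) (γ lam : ℝ)

/-- The gradient step `xₙ - γ ∇fₙ(xₙ)`. -/
def gradStep (s : State G X) (n : Q) : X := s.x n - γ • grad (f n) (s.x n)

/-- `xₙ - γ ∇fₙ(xₙ) - λ yₙ - λ ∑_{m ∼ n} v_{{n,m}}(n)`. -/
def localValue (s : State G X) (n : Q) : X :=
  gradStep f γ s n - lam • s.y n - lam • nodeSum s.v n

/-- The value that agent `d.fst`, when active, gives to its component of `v` on the edge of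
`d`. -/
def newV (s : State G X) (d : G.Dart) : X :=
  (1 / 2 : ℝ) • (localValue f γ lam s d.fst - localValue f γ lam s d.snd)
    + (1 / 2 : ℝ) • (s.v d - s.v d.symm)

/-- The value that agent `n`, when active, gives to `yₙ`. -/
def newY (s : State G X) (n : Q) : X :=
  let w := gradStep f γ s n + (1 - lam) • s.y n - lam • nodeSum s.v n
  w - prox (fun z => ((γ / lam : ℝ) : EReal) * g n z) w

/-- The value that agent `n`, when active, gives to `xₙ`. -/
def newX (s : State G X) (n : Q) : X :=
  gradStep f γ s n - lam • nodeSum (newV f γ lam s) n - lam • newY f g γ lam s n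

/-- One iteration with set `B` of active agents: the active agents update their variables, the
others keep them. -/
def step (B : Finset Q) (s : State G X) : State G X where
  v d := if d.fst ∈ B then newV f γ lam s d else s.v d
  y n := if n ∈ B then newY f g γ lam s n else s.y n
  x n := if n ∈ B then newX f g γ lam s n else s.x n

/-- The iterates `uᵏ = (vᵏ, yᵏ, xᵏ)` started at `u₀`; `B k` is the set of agents that are active
in the passage from `uᵏ` to `uᵏ⁺¹`. -/
def iterates (u₀ : State G X) (B : ℕ → Finset Q) : ℕ → State G X
  | 0 => u₀
  | k + 1 => step f g γ lam (B k) (iterates u₀ B k)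

end

end DASPDFP

/-! Let `fullStep` be the iteration in which every agent is active. At a fixed point the
`x`-components agree and their common value solves the problem (`exists_isSolution_of_fullStep_eq`).
A fixed point exists (`exists_fullStep_eq`): the subdifferential sum rule provides subgradients `uₙ`
at a solution with `∑ (∇fₙ + uₙ) = 0`, and on a connected graph such a balanced family is the
divergence of an antisymmetric edge flow, which serves as `v`.

In the metric `λ(‖v‖² + ‖y‖²) + ‖x‖²` the squared distance to a fixed point drops under `fullStep`
by at least the sum of the `blockGap`s (`sum_blockDist_fullStep_le`). This metric is block diagonal
over the agents. Dividing block `n` by the probability that `n` is active therefore makes the mean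
change under a random step equal to the unweighted change under `fullStep`
(`sum_mul_weightedDist_step`). Distances to fixed points become nonnegative supermartingales, and
the gaps tend to zero almost surely.

Since the bound on `λ` is not strict, a zero gap need not by itself give a fixed point. It does pin
`dualSum` to its value at the reference fixed point. An active agent reaches the `dualSum` of
`fullStep`, so a gap that vanishes both before and after a random update forces a fixed point
(`fullStep_eq_of_blockGap_eq_zero`). The Opial-type argument of `ae_exists_tendsto_orbit` therefore
tracks the gap and its one-step-ahead mean. -/

namespace DASPDFP

/-! ### Random iterations with finitely many maps: Fejér monotonicity in mean -/

section RandomIteration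

open Filter Topology

/-- The orbit of `z₀` under the maps `T (b 0), T (b 1), …`. -/
def orbit {ι E : Type*} (T : ι → E → E) (z₀ : E) (b : ℕ → ι) : ℕ → E
  | 0 => z₀
  | k + 1 => T (b k) (orbit T z₀ b k)

/-- After `k` steps the orbit takes only finitely many values, so any real function of it is
bounded. -/
theorem exists_bound_orbit {ι E : Type*} [Fintype ι] (T : ι → E → E) (z₀ : E) (k : ℕ) :
    ∀ h : E → ℝ, ∃ C, ∀ b : ℕ → ι, ‖h (orbit T z₀ b k)‖ ≤ C := by
  induction k with
  | zero => exact fun h => ⟨‖h z₀‖, fun _ => le_rfl⟩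
  | succ k ih =>
    intro h
    choose C hC using fun b => ih (h ∘ T b)
    refine ⟨∑ b, |C b|, fun b => (hC (b k) b).trans ((le_abs_self _).trans ?_)⟩
    exact Finset.single_le_sum (f := fun b => |C b|) (fun _ _ => abs_nonneg _)
      (Finset.mem_univ (b k))

variable {Ω : Type*} [mΩ : MeasurableSpace Ω] {ι : Type*} [mι : MeasurableSpace ι]

/-- The `σ`-algebras generated by the variables strictly before time `k`. -/
def pastFiltration (ζ : ℕ → Ω → ι) (hζ : ∀ k, Measurable (ζ k)) : Filtration ℕ mΩ where
  seq k := ⨆ j ∈ Set.Iio k, MeasurableSpace.comap (ζ j) mι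
  mono' _ _ hkl := biSup_mono fun _ hj => lt_of_lt_of_le hj hkl
  le' _ := iSup₂_le fun j _ => (hζ j).comap_le

variable {E : Type*} {T : ι → E → E} {z₀ : E} {ζ : ℕ → Ω → ι} {hζ : ∀ k, Measurable (ζ k)}

theorem measurableSet_pastFiltration_eq [MeasurableSingletonClass ι] {j k : ℕ} (hjk : j < k)
    (b : ι) : MeasurableSet[pastFiltration ζ hζ k] {ω | ζ j ω = b} := by
  have h : MeasurableSpace.comap (ζ j) mι ≤ pastFiltration ζ hζ k :=
    le_iSup₂_of_le (f := fun j (_ : j ∈ Set.Iio k) => MeasurableSpace.comap (ζ j) mι) j hjk le_rfl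
  exact h _ ⟨{b}, measurableSet_singleton b, rfl⟩

/-- No σ-algebra on `E` is needed: splitting over the finitely many values of the last index writes
the event as a finite union of past events. -/
theorem measurableSet_orbit_mem [MeasurableSingletonClass ι] [Fintype ι] (k : ℕ) :
    ∀ s : Set E, MeasurableSet[pastFiltration ζ hζ k] {ω | orbit T z₀ (fun j => ζ j ω) k ∈ s} := by
  induction k with
  | zero =>
    intro s
    exact MeasurableSet.const (z₀ ∈ s)
  | succ k ih =>
    intro s
    have h : {ω | orbit T z₀ (fun j => ζ j ω) (k + 1) ∈ s}
        = ⋃ b : ι, {ω | ζ k ω = b} ∩ {ω | orbit T z₀ (fun j => ζ j ω) k ∈ T b ⁻¹' s} := by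
      ext ω
      simp [orbit]
    rw [h]
    exact MeasurableSet.iUnion fun b => (measurableSet_pastFiltration_eq k.lt_succ_self b).inter
      ((pastFiltration ζ hζ).mono k.le_succ _ (ih _))

theorem stronglyMeasurable_comp_orbit [MeasurableSingletonClass ι] [Fintype ι] (k : ℕ)
    (h : E → ℝ) :
    StronglyMeasurable[pastFiltration ζ hζ k] fun ω => h (orbit T z₀ (fun j => ζ j ω) k) :=
  Measurable.stronglyMeasurable fun s _ => measurableSet_orbit_mem k (h ⁻¹' s)

variable {P : Measure Ω} [IsProbabilityMeasure P]

theorem integrable_comp_orbit [MeasurableSingletonClass ι] [Fintype ι]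
    (hζ : ∀ k, Measurable (ζ k)) (k : ℕ) (h : E → ℝ) :
    Integrable (fun ω => h (orbit T z₀ (fun j => ζ j ω) k)) P := by
  obtain ⟨C, hC⟩ := exists_bound_orbit T z₀ k h
  exact Integrable.of_bound ((stronglyMeasurable_comp_orbit (hζ := hζ) k h).mono
    ((pastFiltration ζ hζ).le k)).aestronglyMeasurable C (ae_of_all _ fun ω => hC _)

/-- Decompose over the value `b` of `ζ k`: the indicator of that value is independent of the past,
and its cofactor is past-measurable and pulls out. -/
theorem condExp_comp_orbit_succ [MeasurableSingletonClass ι] [Fintype ι]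
    (hζ : ∀ k, Measurable (ζ k)) (hind : iIndepFun ζ P) (k : ℕ) (h : E → ℝ) :
    P[fun ω => h (orbit T z₀ (fun j => ζ j ω) (k + 1)) | pastFiltration ζ hζ k] =ᵐ[P]
      fun ω => ∑ b, P.real {ω | ζ k ω = b} * h (T b (orbit T z₀ (fun j => ζ j ω) k)) := by
  classical
  let u : ι → Ω → ℝ := fun b ω => h (T b (orbit T z₀ (fun j => ζ j ω) k))
  let w : ι → Ω → ℝ := fun b => {ω | ζ k ω = b}.indicator fun _ => 1
  have hw_meas : ∀ b, StronglyMeasurable[MeasurableSpace.comap (ζ k) mι] (w b) := fun b =>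
    StronglyMeasurable.indicator stronglyMeasurable_const
      ⟨{b}, measurableSet_singleton b, rfl⟩
  have hset : ∀ b, MeasurableSet {ω | ζ k ω = b} := fun b => hζ k (measurableSet_singleton b)
  have hw_int : ∀ b, Integrable (w b) P := fun b => (integrable_const 1).indicator (hset b)
  have hu_meas : ∀ b, StronglyMeasurable[pastFiltration ζ hζ k] (u b) := fun b =>
    stronglyMeasurable_comp_orbit k (h ∘ T b)
  have hu_int : ∀ b, Integrable (u b) P := fun b => integrable_comp_orbit hζ k (h ∘ T b)
  have huw_int : ∀ b, Integrable (u b * w b) P := fun b => by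
    refine ((hu_int b).indicator (hset b)).congr (ae_of_all _ fun ω => ?_)
    simp [w, Set.indicator_apply]
  have hsum : (fun ω => h (orbit T z₀ (fun j => ζ j ω) (k + 1))) = ∑ b, u b * w b := by
    ext ω
    simp [u, w, orbit, Finset.sum_apply, Set.indicator_apply]
  have hindep : Indep (MeasurableSpace.comap (ζ k) mι) (pastFiltration ζ hζ k) P := by
    have := indep_iSup_of_disjoint (fun j => (hζ j).comap_le) hind
      (S := {k}) (T := Set.Iio k) (by simp)
    simpa [pastFiltration] using! this
  have hw : ∀ b, P[w b | pastFiltration ζ hζ k] =ᵐ[P] fun _ => P.real {ω | ζ k ω = b} := by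
    intro b
    refine (condExp_indep_eq (hζ k).comap_le ((pastFiltration ζ hζ).le k) (hw_meas b)
      hindep).trans (ae_of_all _ fun ω => ?_)
    simp [w, integral_indicator (hset b)]
  rw [hsum]
  refine (condExp_finsetSum (fun b _ => huw_int b) _).trans ?_
  have hall : ∀ᵐ ω ∂P, ∀ b, (P[u b * w b | pastFiltration ζ hζ k]) ω
      = u b ω * P.real {ω | ζ k ω = b} := by
    refine ae_all_iff.2 fun b => ?_
    filter_upwards [condExp_mul_of_stronglyMeasurable_left (hu_meas b) (huw_int b) (hw_int b),
      hw b] with ω h1 h2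
    rw [h1, Pi.mul_apply, h2]
  filter_upwards [hall] with ω hω
  rw [Finset.sum_apply]
  exact Finset.sum_congr rfl fun b _ => by rw [hω b, mul_comm]

theorem integral_comp_orbit_succ [MeasurableSingletonClass ι] [Fintype ι]
    (hζ : ∀ k, Measurable (ζ k)) (hind : iIndepFun ζ P) (k : ℕ) (h : E → ℝ) :
    ∫ ω, h (orbit T z₀ (fun j => ζ j ω) (k + 1)) ∂P =
      ∫ ω, ∑ b, P.real {ω | ζ k ω = b} * h (T b (orbit T z₀ (fun j => ζ j ω) k)) ∂P := by
  rw [← integral_condExp ((pastFiltration ζ hζ).le k)]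
  exact integral_congr_ae (condExp_comp_orbit_succ hζ hind k h)

theorem ae_exists_tendsto_comp_orbit [MeasurableSingletonClass ι] [Fintype ι]
    (hζ : ∀ k, Measurable (ζ k)) (hind : iIndepFun ζ P) {h : E → ℝ} (h_nonneg : ∀ z, 0 ≤ h z)
    (h_dec : ∀ k z, ∑ b, P.real {ω | ζ k ω = b} * h (T b z) ≤ h z) :
    ∀ᵐ ω ∂P, ∃ c, Tendsto (fun k => h (orbit T z₀ (fun j => ζ j ω) k)) atTop (𝓝 c) := by
  have hsup : Supermartingale (fun k ω => h (orbit T z₀ (fun j => ζ j ω) k))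
      (pastFiltration ζ hζ) P := by
    refine supermartingale_nat (fun k => stronglyMeasurable_comp_orbit k h)
      (fun k => integrable_comp_orbit hζ k h) fun k => ?_
    filter_upwards [condExp_comp_orbit_succ (T := T) (z₀ := z₀) hζ hind k h] with ω hω
    rw [hω]
    exact h_dec k _
  have hbound : ∀ k, ∫ ω, h (orbit T z₀ (fun j => ζ j ω) k) ∂P ≤ h z₀ := by
    intro k
    have := hsup.setIntegral_le (Nat.zero_le k) MeasurableSet.univ
    simpa [orbit] using! this
  -- Submartingale convergence for the negative; for nonnegative `h` the `L¹` norm is the mean,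
  -- which never exceeds its initial value.
  have hconv := hsup.neg.exists_ae_tendsto_of_bdd (R := (h z₀).toNNReal) fun k => by
    have hint := integrable_comp_orbit (P := P) (T := T) (z₀ := z₀) hζ k h
    rw [Pi.neg_apply, eLpNorm_neg, eLpNorm_one_eq_lintegral_enorm,
      ← ofReal_integral_norm_eq_lintegral_enorm hint]
    refine ENNReal.ofReal_le_ofReal ((integral_congr_ae (ae_of_all _ fun ω => ?_)).trans_le
      (hbound k))
    exact Real.norm_of_nonneg (h_nonneg _)
  filter_upwards [hconv] with ω ⟨c, hc⟩
  exact ⟨-c, by simpa using hc.neg⟩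

/-- By Tonelli the random series has finite mean, hence converges almost surely, and its terms tend
to zero. -/
theorem ae_tendsto_zero_comp_orbit [MeasurableSingletonClass ι] [Fintype ι]
    (hζ : ∀ k, Measurable (ζ k)) {h : E → ℝ} (h_nonneg : ∀ z, 0 ≤ h z) {C : ℝ}
    (h_sum : ∀ N, ∑ k ∈ Finset.range N, ∫ ω, h (orbit T z₀ (fun j => ζ j ω) k) ∂P ≤ C) :
    ∀ᵐ ω ∂P, Tendsto (fun k => h (orbit T z₀ (fun j => ζ j ω) k)) atTop (𝓝 0) := by
  let u : ℕ → Ω → ℝ := fun k ω => h (orbit T z₀ (fun j => ζ j ω) k)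
  have hint : ∀ k, Integrable (u k) P := fun k => integrable_comp_orbit hζ k h
  have hm : ∀ k, AEMeasurable (fun ω => ENNReal.ofReal (u k ω)) P := fun k =>
    (hint k).aestronglyMeasurable.aemeasurable.ennreal_ofReal
  have hfin : ∫⁻ ω, ∑' k, ENNReal.ofReal (u k ω) ∂P ≠ ⊤ := by
    rw [lintegral_tsum hm]
    have hs : Summable fun k => ∫ ω, u k ω ∂P :=
      summable_of_sum_range_le (fun k => integral_nonneg fun ω => h_nonneg _) h_sum
    have := hs.tsum_ofReal_ne_top
    convert this using 3 with k
    exact (ofReal_integral_eq_lintegral_ofReal (hint k) (ae_of_all _ fun ω => h_nonneg _)).symm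
  filter_upwards [ae_lt_top' (AEMeasurable.tsum hm) hfin] with ω hω
  have := (ENNReal.tendsto_toReal ENNReal.zero_ne_top).comp
    (ENNReal.tendsto_atTop_zero_of_tsum_ne_top hω.ne)
  refine Tendsto.congr (fun k => ?_) this
  exact ENNReal.toReal_ofReal (h_nonneg _)

/-- Almost sure convergence of a random iteration that is Fejér monotone in mean with respect to
`F` for the gauges `V a`, `a ∈ F`. -/
theorem ae_exists_tendsto_orbit [MeasurableSingletonClass ι] [Fintype ι]
    [TopologicalSpace E] [TopologicalSpace.PseudoMetrizableSpace E]
    [SecondCountableTopology E]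
    (hζ : ∀ k, Measurable (ζ k)) (hind : iIndepFun ζ P) (hident : ∀ k, IdentDistrib (ζ k) (ζ 0) P P)
    (hT : ∀ b, Continuous (T b)) {F : Set E} {V : E → E → ℝ}
    (hV_left : ∀ z, Continuous fun a => V a z) (hV_right : ∀ a, Continuous (V a))
    (hV_nonneg : ∀ a z, 0 ≤ V a z) (hV_self : ∀ a, V a a = 0) (hV_eq : ∀ a z, V a z = 0 → a = z)
    (hV_compact : ∀ a c, IsCompact {z | V a z ≤ c})
    (hV_dec : ∀ a ∈ F, ∀ z, ∑ b, P.real {ω | ζ 0 ω = b} * V a (T b z) ≤ V a z)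
    {a₀ : E} (ha₀ : a₀ ∈ F) {φ : E → ℝ} (hφ_cont : Continuous φ) (hφ_nonneg : ∀ z, 0 ≤ φ z)
    (hφ_dec : ∀ z, ∑ b, P.real {ω | ζ 0 ω = b} * V a₀ (T b z) ≤ V a₀ z - φ z)
    (hφ_zero : ∀ z, φ z = 0 → (∀ b, 0 < P.real {ω | ζ 0 ω = b} → φ (T b z) = 0) → z ∈ F) (z₀ : E) :
    ∀ᵐ ω ∂P, ∃ z ∈ F, Tendsto (orbit T z₀ fun j => ζ j ω) atTop (𝓝 z) := by
  have hp : ∀ k b, P.real {ω | ζ k ω = b} = P.real {ω | ζ 0 ω = b} := fun k b => by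
    have := (hident k).measure_mem_eq (measurableSet_singleton b)
    exact congrArg ENNReal.toReal this
  -- The mean of `φ` one step ahead. Its expectations along the orbit are those of `φ` shifted by
  -- one, so they are summable too; `hφ_zero` needs both to vanish.
  let ψ : E → ℝ := fun z => ∑ b, P.real {ω | ζ 0 ω = b} * φ (T b z)
  have hψ_nonneg : ∀ z, 0 ≤ ψ z := fun z =>
    Finset.sum_nonneg fun b _ => mul_nonneg measureReal_nonneg (hφ_nonneg _)
  have hψ_cont : Continuous ψ := continuous_finsetSum _ fun b _ =>
    continuous_const.mul (hφ_cont.comp (hT b))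
  have hφ_sum : ∀ N, ∑ k ∈ Finset.range N, ∫ ω, φ (orbit T z₀ (fun j => ζ j ω) k) ∂P
      ≤ V a₀ z₀ - ∫ ω, V a₀ (orbit T z₀ (fun j => ζ j ω) N) ∂P := by
    intro N
    induction N with
    | zero => simp [orbit]
    | succ N ih =>
      have h1 := integral_comp_orbit_succ (T := T) (z₀ := z₀) hζ hind N (V a₀)
      have h2 : ∫ ω, ∑ b, P.real {ω | ζ N ω = b} * V a₀ (T b (orbit T z₀ (fun j => ζ j ω) N)) ∂P
          ≤ ∫ ω, (V a₀ (orbit T z₀ (fun j => ζ j ω) N) - φ (orbit T z₀ (fun j => ζ j ω) N)) ∂P := by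
        refine integral_mono
          (integrable_comp_orbit hζ N fun z => ∑ b, P.real {ω | ζ N ω = b} * V a₀ (T b z))
          (integrable_comp_orbit hζ N fun z => V a₀ z - φ z) fun ω => ?_
        simp only [hp]
        exact hφ_dec _
      rw [integral_sub (integrable_comp_orbit hζ N _) (integrable_comp_orbit hζ N _)] at h2
      rw [Finset.sum_range_succ]
      linarith
  have hφ_sum' : ∀ N, ∑ k ∈ Finset.range N, ∫ ω, φ (orbit T z₀ (fun j => ζ j ω) k) ∂P
      ≤ V a₀ z₀ := fun N => (hφ_sum N).trans (sub_le_self _ (integral_nonneg fun ω => hV_nonneg _ _))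
  have hψ_sum : ∀ N, ∑ k ∈ Finset.range N, ∫ ω, ψ (orbit T z₀ (fun j => ζ j ω) k) ∂P
      ≤ V a₀ z₀ := by
    intro N
    have h1 : ∀ k, ∫ ω, ψ (orbit T z₀ (fun j => ζ j ω) k) ∂P
        = ∫ ω, φ (orbit T z₀ (fun j => ζ j ω) (k + 1)) ∂P := fun k => by
      rw [integral_comp_orbit_succ hζ hind k φ]
      simp only [hp, ψ]
    simp only [h1]
    have h2 := hφ_sum' (N + 1)
    rw [Finset.sum_range_succ'] at h2
    have h3 : 0 ≤ ∫ ω, φ (orbit T z₀ (fun j => ζ j ω) 0) ∂P := integral_nonneg fun ω => hφ_nonneg _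
    linarith
  -- The exceptional null set depends on `a`, so convergence is claimed only for a countable dense
  -- set of `a`, and for `a₀`, which need not belong to it.
  obtain ⟨D, hDF, hD_count, hD_dense⟩ :=
    (TopologicalSpace.IsSeparable.of_separableSpace F).exists_countable_dense_subset
  have hlim : ∀ᵐ ω ∂P, ∀ a ∈ D, ∃ c,
      Tendsto (fun k => V a (orbit T z₀ (fun j => ζ j ω) k)) atTop (𝓝 c) := by
    refine (ae_ball_iff hD_count).2 fun a ha => ?_
    refine ae_exists_tendsto_comp_orbit hζ hind (hV_nonneg a) fun k z => ?_
    simp only [hp]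
    exact hV_dec a (hDF ha) z
  have hlim₀ : ∀ᵐ ω ∂P, ∃ c,
      Tendsto (fun k => V a₀ (orbit T z₀ (fun j => ζ j ω) k)) atTop (𝓝 c) := by
    refine ae_exists_tendsto_comp_orbit hζ hind (hV_nonneg a₀) fun k z => ?_
    simp only [hp]
    exact hV_dec a₀ ha₀ z
  filter_upwards [hlim, hlim₀, ae_tendsto_zero_comp_orbit hζ hφ_nonneg hφ_sum',
    ae_tendsto_zero_comp_orbit hζ hψ_nonneg hψ_sum] with ω h1 h2 h3 h4
  set u : ℕ → E := orbit T z₀ fun j => ζ j ω with hu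
  have cluster_lim : ∀ {h : E → ℝ} {c : ℝ} {z : E}, Continuous h →
      Tendsto (fun k => h (u k)) atTop (𝓝 c) → MapClusterPt z atTop u → h z = c := by
    intro h c z hh hc hz
    have hz' : MapClusterPt (h z) atTop (h ∘ u) := hz.continuousAt_comp hh.continuousAt
    have : (𝓝 (h z) ⊓ 𝓝 c).NeBot := hz'.clusterPt.mono hc
    exact eq_of_nhds_neBot this
  have cluster_mem : ∀ z, MapClusterPt z atTop u → z ∈ F := by
    intro z hz
    have hψz : ψ z = 0 := cluster_lim hψ_cont h4 hz
    refine hφ_zero z (cluster_lim hφ_cont h3 hz) fun b hb => ?_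
    have := (Finset.sum_eq_zero_iff_of_nonneg fun b _ =>
      mul_nonneg measureReal_nonneg (hφ_nonneg _)).1 hψz b (Finset.mem_univ b)
    exact (mul_eq_zero.1 this).resolve_left hb.ne'
  have cluster_unique : ∀ z z', MapClusterPt z atTop u → MapClusterPt z' atTop u → z' = z := by
    intro z z' hz hz'
    -- Opial's argument: two cluster points have the same gauge from every `a` in `D`, hence by
    -- continuity from `z` itself, where `V z z = 0`.
    have hcl : closure D ⊆ {a | V a z' = V a z} := by
      refine closure_minimal (fun a ha => ?_) (isClosed_eq (hV_left _) (hV_left _))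
      obtain ⟨c, hc⟩ := h1 a ha
      exact (cluster_lim (hV_right a) hc hz').trans (cluster_lim (hV_right a) hc hz).symm
    have h5 : V z z' = V z z := hcl (hD_dense (cluster_mem z hz))
    exact (hV_eq z z' (h5.trans (hV_self z))).symm
  obtain ⟨c, hc⟩ := h2
  have hev : ∀ᶠ k in atTop, u k ∈ {z | V a₀ z ≤ c + 1} :=
    (hc.eventually_lt_const (lt_add_one c)).mono fun k hk => hk.le
  obtain ⟨z, -, hz⟩ := (hV_compact a₀ (c + 1)).exists_mapClusterPt_of_frequently hev.frequently
  exact ⟨z, cluster_mem z hz, (hV_compact a₀ (c + 1)).tendsto_nhds_of_unique_mapClusterPt hev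
    fun z' _ hz' => cluster_unique z z' hz hz'⟩

end RandomIteration

/-! ### Smooth convex functions: descent lemma and cocoercivity of the gradient -/

section Smooth

open Set

variable {X : Type*} [NormedAddCommGroup X] [InnerProductSpace ℝ X]

/-- A first-order inequality obtained along a segment. -/
theorem nonneg_of_forall_add_mul_nonneg {A C : ℝ} (h : ∀ t : ℝ, 0 < t → t ≤ 1 → 0 ≤ A + t * C) :
    0 ≤ A := by
  have hc : Filter.Tendsto (fun t : ℝ => A + t * C) (nhdsWithin 0 (Ioi 0)) (nhds (A + 0 * C)) :=
    (Continuous.tendsto (by fun_prop) 0).mono_left nhdsWithin_le_nhds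
  have hev : ∀ᶠ t : ℝ in nhdsWithin 0 (Ioi 0), 0 ≤ A + t * C := by
    filter_upwards [Ioo_mem_nhdsGT (zero_lt_one' ℝ)] with t ht
    exact h t ht.1 ht.2.le
  simpa using ge_of_tendsto hc hev

variable [FiniteDimensional ℝ X] {f : X → ℝ}

theorem hasDerivAt_comp_line (hf : Differentiable ℝ f) (x w : X) (t : ℝ) :
    HasDerivAt (fun t : ℝ => f (x + t • w)) (inner ℝ (grad f (x + t • w)) w) t := by
  have : CompleteSpace X := FiniteDimensional.complete ℝ X
  have h1 : HasDerivAt (fun t : ℝ => x + t • w) w t := by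
    simpa using ((hasDerivAt_id t).smul_const w).const_add x
  have h2 := (hf (x + t • w)).hasGradientAt.hasFDerivAt.comp_hasDerivAt t h1
  simpa [grad] using! h2

theorem add_inner_grad_le (hconv : ConvexOn ℝ univ f) (hf : Differentiable ℝ f) (x z : X) :
    f x + inner ℝ (grad f x) (z - x) ≤ f z := by
  have hline : ConvexOn ℝ univ fun t : ℝ => f (x + t • (z - x)) := by
    have := hconv.comp_affineMap (AffineMap.lineMap x z)
    refine this.congr fun t _ => ?_
    simp [AffineMap.lineMap_apply, add_comm]
  have h := hline.le_slope_of_hasDerivAt (mem_univ 0) (mem_univ 1) zero_lt_one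
    (hasDerivAt_comp_line hf x (z - x) 0)
  simp [slope_def_field] at h
  linarith

theorem le_add_inner_grad_add {L : ℝ} (hf : Differentiable ℝ f)
    (hlip : ∀ x z, ‖grad f x - grad f z‖ ≤ L * ‖x - z‖) (x w : X) :
    f (x + w) ≤ f x + inner ℝ (grad f x) w + L / 2 * ‖w‖ ^ 2 := by
  -- The defect between `f` on the segment and its quadratic upper model; the Lipschitz bound makes
  -- its derivative nonpositive.
  let k : ℝ → ℝ := fun t =>
    f (x + t • w) - (t * inner ℝ (grad f x) w + t ^ 2 * (L / 2 * ‖w‖ ^ 2))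
  have hk : ∀ t, HasDerivAt k (inner ℝ (grad f (x + t • w)) w
      - (inner ℝ (grad f x) w + t * (L * ‖w‖ ^ 2))) t := by
    intro t
    refine (hasDerivAt_comp_line hf x w t).sub ?_
    have h1 := (hasDerivAt_id t).mul_const (inner ℝ (grad f x) w)
    have h2 := ((hasDerivAt_id t).pow 2).mul_const (L / 2 * ‖w‖ ^ 2)
    refine (h1.add h2).congr_deriv ?_
    simp
    ring
  have hanti : AntitoneOn k (Icc 0 1) := by
    refine antitoneOn_of_deriv_nonpos (convex_Icc 0 1)
      (fun t _ => (hk t).continuousAt.continuousWithinAt)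
      (fun t _ => (hk t).differentiableAt.differentiableWithinAt) fun t ht => ?_
    rw [interior_Icc] at ht
    rw [(hk t).deriv]
    have h1 : inner ℝ (grad f (x + t • w) - grad f x) w ≤ L * ‖t • w‖ * ‖w‖ := by
      refine (real_inner_le_norm _ _).trans (mul_le_mul_of_nonneg_right ?_ (norm_nonneg _))
      simpa using hlip (x + t • w) x
    rw [norm_smul, Real.norm_of_nonneg ht.1.le, inner_sub_left] at h1
    nlinarith
  have h := hanti (left_mem_Icc.2 zero_le_one) (right_mem_Icc.2 zero_le_one) zero_le_one
  simp [k] at h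
  linarith

/-- The Baillon-Haddad theorem. -/
theorem grad_cocoercive {β : ℝ} (hβ : 0 < β) (hconv : ConvexOn ℝ univ f)
    (hf : Differentiable ℝ f) (hlip : ∀ x z, ‖grad f x - grad f z‖ ≤ 1 / β * ‖x - z‖) (x y : X) :
    β * ‖grad f x - grad f y‖ ^ 2 ≤ inner ℝ (grad f x - grad f y) (x - y) := by
  -- Compare the tangent bound at `x` with the quadratic bound at `y`, both at `y + β(∇f x - ∇f y)`,
  -- the shift that makes the gain largest. Adding the result to its mirror image gives
  -- cocoercivity.
  have key : ∀ x y, f x + inner ℝ (grad f x) (y - x) + β / 2 * ‖grad f x - grad f y‖ ^ 2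
      ≤ f y := by
    intro x y
    have h1 := add_inner_grad_le hconv hf x (y + β • (grad f x - grad f y))
    have h2 := le_add_inner_grad_add hf hlip y (β • (grad f x - grad f y))
    have h3 : inner ℝ (grad f x) (grad f x - grad f y) - inner ℝ (grad f y) (grad f x - grad f y)
        = ‖grad f x - grad f y‖ ^ 2 := by
      rw [← inner_sub_left, real_inner_self_eq_norm_sq]
    rw [add_sub_right_comm, inner_add_right, real_inner_smul_right] at h1
    rw [real_inner_smul_right, norm_smul, Real.norm_of_nonneg hβ.le] at h2
    have h4 : 1 / β / 2 * (β * ‖grad f x - grad f y‖) ^ 2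
        = β / 2 * ‖grad f x - grad f y‖ ^ 2 := by
      field_simp
    rw [h4] at h2
    have h5 := congrArg (β * ·) h3
    simp only [mul_sub] at h5
    linarith
  have h1 := key x y
  have h2 := key y x
  rw [norm_sub_rev (grad f y)] at h2
  have h3 : inner ℝ (grad f x - grad f y) (x - y)
      = -inner ℝ (grad f x) (y - x) - inner ℝ (grad f y) (x - y) := by
    rw [inner_sub_left, ← inner_neg_right, neg_sub]
  linarith

theorem norm_sub_smul_grad_sq_le {β γ : ℝ} (hβ : 0 < β) (hγ : 0 < γ) (hconv : ConvexOn ℝ univ f)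
    (hf : Differentiable ℝ f) (hlip : ∀ x z, ‖grad f x - grad f z‖ ≤ 1 / β * ‖x - z‖) (x y : X) :
    ‖(x - γ • grad f x) - (y - γ • grad f y)‖ ^ 2
      ≤ ‖x - y‖ ^ 2 - γ * (2 * β - γ) * ‖grad f x - grad f y‖ ^ 2 := by
  have h1 : (x - γ • grad f x) - (y - γ • grad f y) = (x - y) - γ • (grad f x - grad f y) := by
    rw [smul_sub]; abel
  rw [h1, norm_sub_sq_real, real_inner_smul_right, norm_smul, Real.norm_of_nonneg hγ.le,
    real_inner_comm]
  have h2 := grad_cocoercive hβ hconv hf hlip x y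
  nlinarith

theorem continuous_grad {L : ℝ} (hlip : ∀ x z, ‖grad f x - grad f z‖ ≤ L * ‖x - z‖) :
    Continuous (grad f) :=
  (LipschitzWith.of_dist_le_mul (K := L.toNNReal) fun x z => by
    rw [dist_eq_norm, dist_eq_norm]
    exact (hlip x z).trans (mul_le_mul_of_nonneg_right (Real.le_coe_toNNReal L)
      (norm_nonneg _))).continuous

end Smooth

/-! ### Subgradients and the proximity operator -/

section Prox

open Set

variable {X : Type*} [NormedAddCommGroup X] [InnerProductSpace ℝ X] {φ : X → EReal}

/-- `u` is a subgradient of `φ` at `p`. -/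
def IsSubgradient (φ : X → EReal) (p u : X) : Prop :=
  p ∈ effDom φ ∧ ∀ z ∈ effDom φ, (φ p).toReal + inner ℝ u (z - p) ≤ (φ z).toReal

theorem IsSubgradient.monotone {p q u w : X} (hp : IsSubgradient φ p u)
    (hq : IsSubgradient φ q w) : 0 ≤ inner ℝ (u - w) (p - q) := by
  have h1 := hp.2 q hq.1
  have h2 := hq.2 p hp.1
  rw [← neg_sub p q, inner_neg_right] at h1
  rw [inner_sub_left]
  linarith

theorem IsGammaZero.coe_toReal (hφ : IsGammaZero φ) {x : X} (hx : x ∈ effDom φ) :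
    ((φ x).toReal : EReal) = φ x :=
  EReal.coe_toReal (ne_of_lt hx) (hφ.ne_bot x)

theorem IsGammaZero.convexOn (hφ : IsGammaZero φ) :
    ConvexOn ℝ (effDom φ) fun x => (φ x).toReal := by
  have key : ∀ ⦃x⦄, x ∈ effDom φ → ∀ ⦃y⦄, y ∈ effDom φ → ∀ ⦃a b : ℝ⦄, 0 ≤ a → 0 ≤ b → a + b = 1 →
      φ (a • x + b • y) ≤ ((a * (φ x).toReal + b * (φ y).toReal : ℝ) : EReal) := by
    intro x hx y hy a b ha hb hab
    exact hφ.convex (x := (x, (φ x).toReal)) (hφ.coe_toReal hx).ge (y := (y, (φ y).toReal))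
      (hφ.coe_toReal hy).ge ha hb hab
  refine ⟨fun x hx y hy a b ha hb hab => (key hx hy ha hb hab).trans_lt (EReal.coe_lt_top _),
    fun x hx y hy a b ha hb hab => ?_⟩
  exact (EReal.toReal_le_toReal (key hx hy ha hb hab) (hφ.ne_bot _) (EReal.coe_ne_top _)).trans
    (EReal.toReal_coe _).le

theorem IsGammaZero.const_mul (hφ : IsGammaZero φ) {c : ℝ} (hc : 0 < c) :
    IsGammaZero fun z => (c : EReal) * φ z := by
  have hcoe : (0 : EReal) < c := by exact_mod_cast hc
  refine ⟨fun x => ?_, ?_, ?_, ?_⟩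
  · induction h : φ x with
    | bot => exact absurd h (hφ.ne_bot x)
    | coe r => exact_mod_cast EReal.coe_ne_bot (c * r)
    | top => simp [EReal.coe_mul_top_of_pos hc]
  · obtain ⟨x, hx⟩ := hφ.proper
    refine ⟨x, ?_⟩
    rw [← hφ.coe_toReal (lt_top_iff_ne_top.2 hx)]
    exact_mod_cast EReal.coe_ne_top _
  · have hcont : Continuous fun y : EReal => (c : EReal) * y := by
      refine continuous_iff_continuousAt.2 fun y => ?_
      have : ContinuousAt (fun p : EReal × EReal => p.1 * p.2) ((c : EReal), y) :=
        EReal.continuousAt_mul (Or.inl hcoe.ne') (Or.inl hcoe.ne')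
          (Or.inl (EReal.coe_ne_bot c)) (Or.inl (EReal.coe_ne_top c))
      exact this.comp (f := fun y : EReal => ((c : EReal), y)) (by fun_prop)
    exact hcont.comp_lowerSemicontinuous hφ.lsc fun a b hab => mul_le_mul_of_nonneg_left hab hcoe.le
  -- The epigraph of the multiple is the preimage of that of `φ` under `(x, t) ↦ (x, t / c)`.
  · have : {p : X × ℝ | (c : EReal) * φ p.1 ≤ (p.2 : EReal)}
        = (LinearMap.prodMap (LinearMap.id : X →ₗ[ℝ] X) (c⁻¹ • (LinearMap.id : ℝ →ₗ[ℝ] ℝ))) ⁻¹'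
          {p : X × ℝ | φ p.1 ≤ (p.2 : EReal)} := by
      ext ⟨x, t⟩
      simp only [mem_ofPred_eq, mem_preimage, LinearMap.prodMap_apply, LinearMap.id_apply,
        LinearMap.smul_apply, smul_eq_mul]
      induction h : φ x with
      | bot => exact absurd h (hφ.ne_bot x)
      | coe r =>
        rw [← EReal.coe_mul, EReal.coe_le_coe_iff, EReal.coe_le_coe_iff, inv_mul_eq_div,
          le_div_iff₀' hc]
      | top => simp [EReal.coe_mul_top_of_pos hc, -EReal.coe_mul]
    rw [this]
    exact hφ.convex.linear_preimage _

theorem effDom_const_mul {c : ℝ} (hc : 0 < c) (hφ : IsGammaZero φ) :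
    effDom (fun z => (c : EReal) * φ z) = effDom φ := by
  ext x
  simp only [effDom, mem_ofPred_eq]
  induction h : φ x with
  | bot => exact absurd h (hφ.ne_bot x)
  | coe r => simp [← EReal.coe_mul, EReal.coe_lt_top]
  | top => simp [EReal.coe_mul_top_of_pos hc]

theorem isSubgradient_const_mul_iff {c : ℝ} (hc : 0 < c) (hφ : IsGammaZero φ) {p u : X} :
    IsSubgradient (fun z => (c : EReal) * φ z) p u ↔ IsSubgradient φ p (c⁻¹ • u) := by
  simp only [IsSubgradient, effDom_const_mul hc hφ, EReal.toReal_mul, EReal.toReal_coe]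
  refine and_congr_right fun _ => forall₂_congr fun z _ => ?_
  rw [real_inner_smul_left, ← mul_le_mul_iff_of_pos_left hc (b := _ + c⁻¹ * _), mul_add,
    mul_inv_cancel_left₀ hc.ne']

variable (φ) in
/-- The objective minimized by the proximity operator. -/
noncomputable def proxObjective (x z : X) : EReal := φ z + ((‖x - z‖ ^ 2 / 2 : ℝ) : EReal)

theorem IsGammaZero.proxObjective_eq (hφ : IsGammaZero φ) (x : X) {z : X} (hz : z ∈ effDom φ) :
    proxObjective φ x z = (((φ z).toReal + ‖x - z‖ ^ 2 / 2 : ℝ) : EReal) := by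
  rw [proxObjective, EReal.coe_add, hφ.coe_toReal hz]

theorem IsGammaZero.lowerSemicontinuous_proxObjective (hφ : IsGammaZero φ) (x : X) :
    LowerSemicontinuous (proxObjective φ x) := by
  refine hφ.lsc.add' (Continuous.lowerSemicontinuous ?_) fun z =>
    EReal.continuousAt_add (Or.inr (EReal.coe_ne_bot _)) (Or.inr (EReal.coe_ne_top _))
  exact continuous_coe_real_ereal.comp (by fun_prop)

/-- Lower semicontinuity bounds `φ` below on the compact unit ball around `x₀`; beyond it, convexity
along the ray from `x₀` lets `φ` fall at most linearly. The constant is the drop from `x₀` to the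
minimum on the ball. -/
theorem IsGammaZero.exists_toReal_lower_bound [FiniteDimensional ℝ X] (hφ : IsGammaZero φ) {x₀ : X}
    (hx₀ : x₀ ∈ effDom φ) :
    ∃ K, 0 ≤ K ∧ ∀ z ∈ effDom φ, (φ x₀).toReal - K - K * ‖z - x₀‖ ≤ (φ z).toReal := by
  have : ProperSpace X := FiniteDimensional.proper ℝ X
  obtain ⟨m, hm, hmin⟩ := (hφ.lsc.lowerSemicontinuousOn
    (Metric.closedBall x₀ 1)).exists_isMinOn ⟨x₀, by simp⟩ (isCompact_closedBall x₀ 1)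
  have hball : ∀ z ∈ Metric.closedBall x₀ 1, φ m ≤ φ z := fun z hz => hmin hz
  have hm_dom : m ∈ effDom φ := (hball x₀ (by simp)).trans_lt hx₀
  have hball' : ∀ z ∈ Metric.closedBall x₀ 1, z ∈ effDom φ → (φ m).toReal ≤ (φ z).toReal :=
    fun z hz hz' => EReal.toReal_le_toReal (hball z hz) (hφ.ne_bot m) (ne_of_lt hz')
  have hK : 0 ≤ (φ x₀).toReal - (φ m).toReal := sub_nonneg.2 (hball' x₀ (by simp) hx₀)
  refine ⟨(φ x₀).toReal - (φ m).toReal, hK, fun z hz => ?_⟩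
  rcases le_total ‖z - x₀‖ 1 with h | h
  · have := hball' z (by simpa [dist_eq_norm] using h) hz
    nlinarith [norm_nonneg (z - x₀)]
  · have hr : 0 < ‖z - x₀‖ := zero_lt_one.trans_le h
    set r := ‖z - x₀‖ with hr_def
    have hr1 : r⁻¹ ≤ 1 := inv_le_one_of_one_le₀ h
    have hconv := hφ.convexOn.2 hx₀ hz (sub_nonneg.2 hr1) (inv_nonneg.2 hr.le)
      (sub_add_cancel 1 r⁻¹)
    have hmem := hφ.convexOn.1 hx₀ hz (sub_nonneg.2 hr1) (inv_nonneg.2 hr.le)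
      (sub_add_cancel 1 r⁻¹)
    have heq : (1 - r⁻¹) • x₀ + r⁻¹ • z - x₀ = r⁻¹ • (z - x₀) := by module
    have hin : (1 - r⁻¹) • x₀ + r⁻¹ • z ∈ Metric.closedBall x₀ 1 := by
      rw [Metric.mem_closedBall, dist_eq_norm, heq, norm_smul, ← hr_def, norm_inv,
        Real.norm_of_nonneg hr.le, inv_mul_cancel₀ hr.ne']
    have h1 := (hball' _ hin hmem).trans hconv
    simp only [smul_eq_mul] at h1
    have h2 := mul_le_mul_of_nonneg_left h1 hr.le
    have h3 : r * ((1 - r⁻¹) * (φ x₀).toReal + r⁻¹ * (φ z).toReal)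
        = r * (φ x₀).toReal - (φ x₀).toReal + (φ z).toReal := by
      field_simp
    nlinarith

theorem IsGammaZero.exists_isMinOn_proxObjective [FiniteDimensional ℝ X] (hφ : IsGammaZero φ)
    (x : X) : ∃ p, IsMinOn (proxObjective φ x) univ p := by
  have : ProperSpace X := FiniteDimensional.proper ℝ X
  obtain ⟨x₀, hx₀⟩ := hφ.proper
  replace hx₀ : x₀ ∈ effDom φ := lt_top_iff_ne_top.2 hx₀
  obtain ⟨K, hK, hbound⟩ := hφ.exists_toReal_lower_bound hx₀
  set d := ‖x - x₀‖
  have hd : 0 ≤ d := norm_nonneg _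
  -- For `r` beyond the radius `2(d + K + 1)`, `r²/2 - (d + K)r ≥ r ≥ K`, so the quadratic beats the
  -- linear lower bound and points outside the ball do no better than `x₀`.
  obtain ⟨p, -, hp⟩ := ((hφ.lowerSemicontinuous_proxObjective x).lowerSemicontinuousOn
    (Metric.closedBall x₀ (2 * (d + K + 1)))).exists_isMinOn
    ⟨x₀, Metric.mem_closedBall_self (by positivity)⟩ (isCompact_closedBall _ _)
  refine ⟨p, fun z _ => ?_⟩
  by_cases hz : z ∈ Metric.closedBall x₀ (2 * (d + K + 1))
  · exact hp hz
  · refine (show proxObjective φ x p ≤ _ from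
      hp (Metric.mem_closedBall_self (by positivity))).trans ?_
    by_cases hz_dom : z ∈ effDom φ
    · rw [hφ.proxObjective_eq x hx₀, hφ.proxObjective_eq x hz_dom, EReal.coe_le_coe_iff]
      rw [Metric.mem_closedBall, dist_eq_norm, not_le] at hz
      have h1 := hbound z hz_dom
      have h2 : ‖z - x₀‖ - d ≤ ‖x - z‖ := by
        have := norm_sub_norm_le (z - x₀) (x - x₀)
        rw [sub_sub_sub_cancel_right, norm_sub_rev z x] at this
        exact this
      set r := ‖z - x₀‖
      have h3 : (r - d) ^ 2 ≤ ‖x - z‖ ^ 2 := pow_le_pow_left₀ (by linarith) h2 2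
      nlinarith
    · have : proxObjective φ x z = ⊤ := by
        rw [proxObjective, not_lt_top_iff.1 (show ¬φ z < ⊤ from hz_dom), EReal.top_add_coe]
      exact this ▸ le_top

theorem IsGammaZero.isSubgradient_of_isMinOn (hφ : IsGammaZero φ) {x p : X}
    (hp : IsMinOn (proxObjective φ x) univ p) : IsSubgradient φ p (x - p) := by
  obtain ⟨x₀, hx₀⟩ := hφ.proper
  replace hx₀ : x₀ ∈ effDom φ := lt_top_iff_ne_top.2 hx₀
  have hmin : ∀ z, proxObjective φ x p ≤ proxObjective φ x z := fun z => hp (mem_univ z)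
  have hp_dom : p ∈ effDom φ := by
    by_contra h
    have h1 : proxObjective φ x p = ⊤ := by
      rw [proxObjective, not_lt_top_iff.1 (show ¬φ p < ⊤ from h), EReal.top_add_coe]
    have h2 := hmin x₀
    rw [h1, hφ.proxObjective_eq x hx₀, top_le_iff] at h2
    exact EReal.coe_ne_top _ h2
  refine ⟨hp_dom, fun z hz => ?_⟩
  -- Compare `p` with `(1 - t)p + tz`, divide by `t` and let `t → 0`.
  have key := nonneg_of_forall_add_mul_nonneg
    (A := (φ z).toReal - (φ p).toReal - inner ℝ (x - p) (z - p)) (C := ‖z - p‖ ^ 2 / 2) ?_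
  · linarith
  intro t ht0 ht1
  have hmem := hφ.convexOn.1 hp_dom hz (sub_nonneg.2 ht1) ht0.le (sub_add_cancel 1 t)
  have hconv := hφ.convexOn.2 hp_dom hz (sub_nonneg.2 ht1) ht0.le (sub_add_cancel 1 t)
  have h1 := hmin ((1 - t) • p + t • z)
  rw [hφ.proxObjective_eq x hp_dom, hφ.proxObjective_eq x hmem, EReal.coe_le_coe_iff] at h1
  have h2 : x - ((1 - t) • p + t • z) = (x - p) - t • (z - p) := by module
  rw [h2, norm_sub_sq_real (x - p), real_inner_smul_right, norm_smul, Real.norm_of_nonneg ht0.le] at h1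
  simp only [smul_eq_mul] at hconv
  have h3 : 0 ≤ t * ((φ z).toReal - (φ p).toReal - inner ℝ (x - p) (z - p)
      + t * (‖z - p‖ ^ 2 / 2)) := by
    nlinarith
  exact nonneg_of_mul_nonneg_right h3 ht0

variable [FiniteDimensional ℝ X]

theorem IsGammaZero.isSubgradient_prox (hφ : IsGammaZero φ) (x : X) :
    IsSubgradient φ (prox φ x) (x - prox φ x) :=
  hφ.isSubgradient_of_isMinOn (Classical.epsilon_spec (hφ.exists_isMinOn_proxObjective x))

/-- Monotonicity applied to `p` and `prox φ (p + u)` gives `-‖p - prox φ (p + u)‖² ≥ 0`. -/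
theorem IsGammaZero.prox_add_eq (hφ : IsGammaZero φ) {p u : X} (h : IsSubgradient φ p u) :
    prox φ (p + u) = p := by
  have h1 := h.monotone (hφ.isSubgradient_prox (p + u))
  rw [show u - (p + u - prox φ (p + u)) = -(p - prox φ (p + u)) by abel, inner_neg_left,
    real_inner_self_eq_norm_sq] at h1
  have h2 : ‖p - prox φ (p + u)‖ = 0 := by
    have := sq_nonneg ‖p - prox φ (p + u)‖
    exact pow_eq_zero_iff two_ne_zero |>.1 (by linarith)
  exact (sub_eq_zero.1 (norm_eq_zero.1 h2)).symm

/-- Firm nonexpansiveness of `I - prox`. -/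
theorem IsGammaZero.norm_sub_prox_sub_sq_le (hφ : IsGammaZero φ) (x y : X) :
    ‖(x - prox φ x) - (y - prox φ y)‖ ^ 2 ≤ inner ℝ ((x - prox φ x) - (y - prox φ y)) (x - y) := by
  have h := (hφ.isSubgradient_prox x).monotone (hφ.isSubgradient_prox y)
  have h1 : x - y = ((x - prox φ x) - (y - prox φ y)) + (prox φ x - prox φ y) := by abel
  conv_rhs => rw [h1, inner_add_right, real_inner_self_eq_norm_sq]
  linarith

theorem IsGammaZero.continuous_prox (hφ : IsGammaZero φ) : Continuous (prox φ) := by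
  have hlip : LipschitzWith 1 fun x => x - prox φ x := LipschitzWith.mk_one fun x y => by
    rw [dist_eq_norm, dist_eq_norm]
    have h1 := (hφ.norm_sub_prox_sub_sq_le x y).trans (real_inner_le_norm _ _)
    rcases (norm_nonneg ((x - prox φ x) - (y - prox φ y))).eq_or_lt with h | h
    · rw [← h]; exact norm_nonneg _
    · rw [sq] at h1
      exact le_of_mul_le_mul_left h1 h
  refine (continuous_id.sub hlip.continuous).congr fun x => ?_
  simp

end Prox

/-! ### Proper separation and the subdifferential sum rule -/

section SumRule

open Set

/-- Proper separation of the origin from a convex set in finite dimension. -/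
theorem exists_linearMap_nonneg_pos {V : Type*} [NormedAddCommGroup V] [NormedSpace ℝ V]
    [FiniteDimensional ℝ V] {A : Set V} (hA : Convex ℝ A) (hne : A.Nonempty) (h0 : (0 : V) ∉ A) :
    ∃ ℓ : V →ₗ[ℝ] ℝ, (∀ a ∈ A, 0 ≤ ℓ a) ∧ ∃ a ∈ A, 0 < ℓ a := by
  -- Inside its span the set either has interior points or lies in an affine hyperplane.
  let W := Submodule.span ℝ A
  let A' : Set W := W.subtype ⁻¹' A
  have hA' : Convex ℝ A' := hA.linear_preimage _
  have himage : ∀ a ∈ A, ∃ a' ∈ A', (a' : V) = a := fun a ha =>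
    ⟨⟨a, Submodule.subset_span ha⟩, ha, rfl⟩
  have hspan : Submodule.span ℝ A' = ⊤ := by
    have h : Submodule.map W.subtype (Submodule.span ℝ A') = Submodule.map W.subtype ⊤ := by
      rw [Submodule.map_span, Submodule.map_subtype_top]
      congr 1
      ext a
      exact ⟨fun ⟨a', ha', h⟩ => h ▸ ha', fun ha => himage a ha⟩
    exact Submodule.map_injective_of_injective W.injective_subtype h
  have hne' : A'.Nonempty := by
    obtain ⟨a, ha⟩ := hne
    obtain ⟨a', ha', -⟩ := himage a ha
    exact ⟨a', ha'⟩
  suffices h : ∃ ℓ : W →ₗ[ℝ] ℝ, (∀ a ∈ A', 0 ≤ ℓ a) ∧ ∃ a ∈ A', 0 < ℓ a by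
    obtain ⟨ℓ, h1, a', ha', h2⟩ := h
    obtain ⟨ℓ', hℓ'⟩ := ℓ.exists_extend
    have heq : ∀ w : W, ℓ' w = ℓ w := fun w => LinearMap.congr_fun hℓ' w
    refine ⟨ℓ', fun a ha => ?_, a', ha', (heq a').symm ▸ h2⟩
    obtain ⟨b, hb, rfl⟩ := himage a ha
    exact (heq b).symm ▸ h1 b hb
  by_cases hint : (interior A').Nonempty
  · obtain ⟨ℓ, hℓ⟩ := geometric_hahn_banach_open_point hA'.interior isOpen_interior
      (fun h => h0 (show (0 : W) ∈ A' from interior_subset h) : (0 : W) ∉ interior A')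
    simp only [map_zero] at hℓ
    refine ⟨-ℓ.toLinearMap, fun a ha => ?_, ?_⟩
    · have hcl : A' ⊆ closure (interior A') := by
        rw [hA'.closure_interior_eq_closure_of_nonempty_interior hint]
        exact subset_closure
      have hle : closure (interior A') ⊆ {a | ℓ a ≤ 0} :=
        closure_minimal (fun a ha => (hℓ a ha).le) (isClosed_le ℓ.continuous continuous_const)
      have := hle (hcl ha)
      simpa using! this
    · obtain ⟨a, ha⟩ := hint
      exact ⟨a, interior_subset ha, by simpa using! hℓ a ha⟩
  · rw [hA'.interior_nonempty_iff_affineSpan_eq_top] at hint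
    -- An affine span through the origin would be all of `W`. A functional killing its direction is
    -- thus a nonzero constant on `A'`; multiplying it by this constant fixes the sign.
    have h0_span : (0 : W) ∉ affineSpan ℝ A' := by
      intro h
      refine hint (AffineSubspace.ext_of_direction_eq ?_ ⟨0, h, AffineSubspace.mem_top ℝ W 0⟩)
      rw [AffineSubspace.direction_top, eq_top_iff, ← hspan, Submodule.span_le]
      intro a ha
      have := AffineSubspace.vsub_mem_direction (subset_affineSpan ℝ A' ha) h
      simpa using this
    obtain ⟨a₀, ha₀⟩ := hne'
    have ha₀_dir : a₀ ∉ (affineSpan ℝ A').direction := by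
      intro h
      have := AffineSubspace.vadd_mem_of_mem_direction (Submodule.neg_mem _ h)
        (subset_affineSpan ℝ A' ha₀)
      exact h0_span (by simpa using this)
    obtain ⟨ℓ, hℓ_ne, hℓ⟩ := Submodule.exists_le_ker_of_notMem ha₀_dir
    have hconst : ∀ a ∈ A', ℓ a = ℓ a₀ := fun a ha => by
      have h := hℓ (AffineSubspace.vsub_mem_direction (subset_affineSpan ℝ A' ha)
        (subset_affineSpan ℝ A' ha₀))
      rw [LinearMap.mem_ker, vsub_eq_sub, map_sub] at h
      exact sub_eq_zero.1 h
    have hpos : 0 < ℓ a₀ * ℓ a₀ := mul_self_pos.2 hℓ_ne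
    refine ⟨ℓ a₀ • ℓ, fun a ha => ?_, a₀, ha₀, hpos⟩
    rw [LinearMap.smul_apply, hconst a ha]
    exact hpos.le

/-- The prolonged segment stays in the affine span, where `z₀` is an interior point. -/
theorem eventually_extend_mem_of_mem_intrinsicInterior {V : Type*} [NormedAddCommGroup V]
    [NormedSpace ℝ V] {C : Set V} {z₀ x : V} (hz₀ : z₀ ∈ intrinsicInterior ℝ C) (hx : x ∈ C) :
    ∀ᶠ ε : ℝ in nhds 0, z₀ - ε • (x - z₀) ∈ C := by
  obtain ⟨y, hy, rfl⟩ := mem_intrinsicInterior.1 hz₀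
  have hmem : ∀ ε : ℝ, (y : V) - ε • (x - y) ∈ affineSpan ℝ C := fun ε => by
    have := AffineMap.lineMap_mem (-ε) y.2 (subset_affineSpan ℝ C hx)
    convert this using 1
    rw [AffineMap.lineMap_apply, vsub_eq_sub, vadd_eq_add]
    module
  let c : ℝ → affineSpan ℝ C := fun ε => ⟨(y : V) - ε • (x - y), hmem ε⟩
  have hc : Continuous c := by
    refine Continuous.subtype_mk ?_ _
    fun_prop
  have hc0 : c 0 = y := Subtype.ext (by simp [c])
  have := hc.continuousAt.preimage_mem_nhds (x := 0) (by
    rw [hc0]; exact mem_interior_iff_mem_nhds.1 hy)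
  exact this

variable {X : Type*} [NormedAddCommGroup X] [InnerProductSpace ℝ X] [FiniteDimensional ℝ X]
  {Q : Type*} [Fintype Q] [DecidableEq Q]

/-- Fermat's rule combined with the subdifferential sum rule, under the relative interior
qualification condition. -/
theorem exists_sum_eq_zero_of_isMinOn_sum {C : Q → Set X} {h : Q → X → ℝ}
    (hh : ∀ n, ConvexOn ℝ (C n) (h n)) {xs z₀ : X} (hxs : ∀ n, xs ∈ C n)
    (hz₀ : ∀ n, z₀ ∈ intrinsicInterior ℝ (C n))
    (hmin : ∀ z, (∀ n, z ∈ C n) → ∑ n, h n xs ≤ ∑ n, h n z) :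
    ∃ u : Q → X, ∑ n, u n = 0 ∧ ∀ n, ∀ z ∈ C n, h n xs + inner ℝ (u n) (z - xs) ≤ h n z := by
  have : CompleteSpace X := FiniteDimensional.complete ℝ X
  let s : (Q → X) → ℝ := fun x => ∑ n, (h n (x n) - h n xs)
  -- Each function gets its own copy of the variable, and deviations from the diagonal are recorded
  -- along with values above the optimum. Optimality of `xs` says that the origin is not in this
  -- set.
  let A : Set ((Q → X) × ℝ) :=
    {p | ∃ x z, (∀ n, x n ∈ C n) ∧ p.1 = (x - Function.const Q z) ∧ s x < p.2}
  have hA : Convex ℝ A := by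
    rintro p ⟨x, z, hx, hp, hs⟩ p' ⟨x', z', hx', hp', hs'⟩ a b ha hb hab
    refine ⟨a • x + b • x', a • z + b • z', fun n => (hh n).1 (hx n) (hx' n) ha hb hab, ?_, ?_⟩
    · ext n
      simp only [Prod.fst_add, Prod.smul_fst, hp, hp', Pi.add_apply, Pi.smul_apply, Pi.sub_apply,
        Function.const_apply]
      module
    · have h1 : s (a • x + b • x') ≤ a * s x + b * s x' := by
        simp only [s, Finset.mul_sum, ← Finset.sum_add_distrib]
        refine Finset.sum_le_sum fun n _ => ?_
        have := (hh n).2 (hx n) (hx' n) ha hb hab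
        simp only [smul_eq_mul] at this
        have h2 : a * h n xs + b * h n xs = h n xs := by rw [← add_mul, hab, one_mul]
        simp only [Pi.add_apply, Pi.smul_apply]
        linarith
      refine h1.trans_lt ?_
      simp only [Prod.snd_add, Prod.smul_snd, smul_eq_mul]
      rcases ha.eq_or_lt with rfl | ha'
      · obtain rfl : b = 1 := by linarith
        linarith
      · nlinarith [mul_lt_mul_of_pos_left hs ha', mul_le_mul_of_nonneg_left hs'.le hb]
  have h0 : (0 : (Q → X) × ℝ) ∉ A := by
    rintro ⟨x, z, hx, hp, hs⟩
    have hxz : ∀ n, x n = z := fun n => by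
      have := congrFun hp n
      simpa [sub_eq_zero, eq_comm] using this
    have h1 := hmin z fun n => hxz n ▸ hx n
    simp only [s, hxz, Finset.sum_sub_distrib, Prod.snd_zero] at hs
    linarith
  have hs_xs : s (Function.const Q xs) = 0 := by simp [s]
  have hne : A.Nonempty := ⟨(0, 1), Function.const Q xs, xs, hxs, by simp, by rw [hs_xs]; simp⟩
  obtain ⟨ℓ, hℓ, ⟨w₀, t₀⟩, hp₀, hpos⟩ := exists_linearMap_nonneg_pos hA hne h0
  let L : (Q → X) →ₗ[ℝ] ℝ := ℓ ∘ₗ LinearMap.inl ℝ (Q → X) ℝ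
  set τ : ℝ := ℓ (0, 1) with hτ
  have hℓ_eq : ∀ w t, ℓ (w, t) = L w + τ * t := fun w t => by
    have : ((w, t) : (Q → X) × ℝ) = (w, 0) + t • (0, 1) := by simp
    rw [this, map_add, map_smul, smul_eq_mul, mul_comm]
    rfl
  have hineq : ∀ x z t, (∀ n, x n ∈ C n) → s x < t → 0 ≤ L x - L (Function.const Q z) + τ * t := by
    intro x z t hx ht
    have := hℓ (x - Function.const Q z, t) ⟨x, z, hx, rfl, ht⟩
    rwa [hℓ_eq, map_sub] at this
  have hτ_nonneg : 0 ≤ τ := by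
    have := hineq (Function.const Q xs) xs 1 hxs (by rw [hs_xs]; exact one_pos)
    linarith
  -- The diagonal point is unconstrained, so a nonzero value could be scaled to break the
  -- inequality.
  have hL_const : ∀ z, L (Function.const Q z) = 0 := by
    intro z
    by_contra hz
    have h1 := hineq (Function.const Q xs)
      (((L (Function.const Q xs) + τ + 1) / L (Function.const Q z)) • z) 1 hxs
      (by rw [hs_xs]; exact one_pos)
    have h2 : Function.const Q (((L (Function.const Q xs) + τ + 1) / L (Function.const Q z)) • z)
        = ((L (Function.const Q xs) + τ + 1) / L (Function.const Q z)) • Function.const Q z := rfl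
    rw [h2, map_smul, smul_eq_mul, div_mul_cancel₀ _ hz] at h1
    linarith
  have hineq' : ∀ x, (∀ n, x n ∈ C n) → 0 ≤ L x + τ * s x := by
    intro x hx
    refine nonneg_of_forall_add_mul_nonneg (C := τ) fun t ht _ => ?_
    have := hineq x 0 (s x + t) hx (lt_add_of_pos_right _ ht)
    rw [hL_const] at this
    linarith
  -- The qualification condition enters here. If `τ = 0`, proper separation gives an admissible `x`
  -- with `L x > 0`; reflecting it slightly through `z₀` stays admissible and makes `L` negative.
  have hτ_pos : 0 < τ := by
    refine hτ_nonneg.lt_of_ne fun hτ0 => ?_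
    rw [← hτ0] at hineq'
    obtain ⟨x, z, hx, hw, -⟩ := hp₀
    simp only at hw
    rw [hℓ_eq, ← hτ0, hw, map_sub, hL_const] at hpos
    have hev : ∀ᶠ ε : ℝ in nhdsWithin 0 (Ioi 0), ∀ n, z₀ - ε • (x n - z₀) ∈ C n :=
      (Filter.eventually_all.2 fun n => eventually_extend_mem_of_mem_intrinsicInterior
        (hz₀ n) (hx n)).filter_mono nhdsWithin_le_nhds
    obtain ⟨ε, hε, hε_pos⟩ := (hev.and self_mem_nhdsWithin).exists
    have h1 := hineq' (fun n => z₀ - ε • (x n - z₀)) hε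
    have h2 : (fun n => z₀ - ε • (x n - z₀))
        = Function.const Q z₀ - ε • (x - Function.const Q z₀) := rfl
    rw [h2, map_sub, map_smul, map_sub, hL_const, smul_eq_mul] at h1
    have h3 : 0 < ε * L x := mul_pos hε_pos (by linarith)
    linarith
  let Ln : Q → X →L[ℝ] ℝ := fun n =>
    LinearMap.toContinuousLinearMap (L ∘ₗ LinearMap.single ℝ (fun _ => X) n)
  let v : Q → X := fun n => (InnerProductSpace.toDual ℝ X).symm (Ln n)
  have hv : ∀ n y, inner ℝ (v n) y = L (Pi.single n y) := fun n y => by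
    simp [v, Ln, InnerProductSpace.toDual_symm_apply]
  refine ⟨fun n => -(τ⁻¹ • v n), ?_, fun n z hz => ?_⟩
  · refine ext_inner_right ℝ fun y => ?_
    have h1 : ∑ n, L (Pi.single n y) = 0 := by
      rw [← map_sum, ← hL_const y]
      congr 1
      exact Finset.univ_sum_single (Function.const Q y)
    rw [sum_inner, inner_zero_left]
    simp only [inner_neg_left, real_inner_smul_left, hv]
    rw [Finset.sum_neg_distrib, ← Finset.mul_sum, h1, mul_zero, neg_zero]
  · have h1 := hineq' (Function.update (Function.const Q xs) n z) fun m => by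
      rcases eq_or_ne m n with rfl | hm
      · simpa using hz
      · simpa [hm] using hxs m
    have h2 : Function.update (Function.const Q xs) n z
        = Function.const Q xs + Pi.single n (z - xs) := by
      ext m
      rcases eq_or_ne m n with rfl | hm
      · simp
      · simp [hm]
    have h3 : s (Function.update (Function.const Q xs) n z) = h n z - h n xs := by
      simp only [s]
      rw [Finset.sum_eq_single n]
      · simp
      · intro m _ hm
        simp [hm]
      · simp
    rw [h3, h2, map_add, hL_const, zero_add, ← hv] at h1
    rw [inner_neg_left, real_inner_smul_left]
    have h4 := mul_nonneg (inv_nonneg.2 hτ_nonneg) h1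
    rw [mul_add, inv_mul_cancel_left₀ hτ_pos.ne'] at h4
    linarith

end SumRule

/-! ### Flows on the graph and the spectrum of `DDᵀ` -/

section Network

variable {X : Type*} [NormedAddCommGroup X]
  {Q : Type*} [Fintype Q] [DecidableEq Q] {G : SimpleGraph Q} [DecidableRel G.Adj]

theorem nodeSum_add (v w : G.Dart → X) (n : Q) :
    nodeSum (v + w) n = nodeSum v n + nodeSum w n :=
  Finset.sum_add_distrib

theorem nodeSum_sub (v w : G.Dart → X) (n : Q) :
    nodeSum (v - w) n = nodeSum v n - nodeSum w n :=
  Finset.sum_sub_distrib _ _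

theorem sum_nodeSum (v : G.Dart → X) : ∑ n, nodeSum v n = ∑ d, v d :=
  Finset.sum_fiberwise _ _ _

theorem sum_dart_symm {M : Type*} [AddCommMonoid M] {V : Type*}
    [Fintype V] {G : SimpleGraph V} [DecidableRel G.Adj] (v : G.Dart → M) :
    ∑ d : G.Dart, v d.symm = ∑ d, v d :=
  Equiv.sum_comp (Function.Involutive.toPerm _ SimpleGraph.Dart.symm_involutive) v

theorem sum_eq_zero_of_antisymm {M : Type*} [AddCommGroup M] [Module ℝ M] {V : Type*}
    [Fintype V] {G : SimpleGraph V} [DecidableRel G.Adj] {v : G.Dart → M}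
    (hv : ∀ d, v d.symm = -v d) : ∑ d, v d = 0 := by
  have h := sum_dart_symm v
  simp only [hv, Finset.sum_neg_distrib] at h
  have h2 : (2 : ℝ) • ∑ d, v d = 0 := by
    rw [two_smul]
    nth_rewrite 1 [← h]
    exact neg_add_cancel _
  exact (smul_eq_zero.1 h2).resolve_left two_ne_zero

/-- `b` is the divergence of an antisymmetric flow. -/
def IsDivergence (G : SimpleGraph Q) [DecidableRel G.Adj] (b : Q → X) : Prop :=
  ∃ v : G.Dart → X, (∀ d, v d.symm = -v d) ∧ ∀ n, nodeSum v n = b n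

theorem isDivergence_zero : IsDivergence G (0 : Q → X) :=
  ⟨0, by simp, fun n => by simp [nodeSum]⟩

theorem IsDivergence.add {b c : Q → X} (hb : IsDivergence G b) (hc : IsDivergence G c) :
    IsDivergence G (b + c) := by
  obtain ⟨v, hv, hvb⟩ := hb
  obtain ⟨w, hw, hwc⟩ := hc
  exact ⟨v + w, fun d => by simp [hv, hw, add_comm], fun n => by
    rw [nodeSum_add, hvb, hwc, Pi.add_apply]⟩

theorem isDivergence_single_sub_single_of_adj {n m : Q} (h : G.Adj n m) (c : X) :
    IsDivergence G (Pi.single n c - Pi.single m c : Q → X) := by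
  let d₀ : G.Dart := ⟨(n, m), h⟩
  refine ⟨Pi.single d₀ c - Pi.single d₀.symm c, fun d => ?_, fun k => ?_⟩
  · have h1 : d.symm = d₀ ↔ d = d₀.symm := SimpleGraph.Dart.symm_involutive.eq_iff
    have h2 : d.symm = d₀.symm ↔ d = d₀ := SimpleGraph.Dart.symm_involutive.injective.eq_iff
    simp [Pi.single_apply, h1, h2]
  · have h3 : ∀ e : G.Dart, nodeSum (Pi.single e c) k = (Pi.single e.fst c : Q → X) k := fun e => by
      rw [nodeSum, Finset.sum_filter]
      rw [Finset.sum_eq_single e (fun d _ hd => by simp [hd]) (by simp)]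
      simp [Pi.single_apply, eq_comm]
    rw [nodeSum_sub, h3, h3]
    rfl

/-- Send `c` along a walk: the contributions at intermediate nodes telescope. -/
theorem isDivergence_single_sub_single {n m : Q} (h : G.Reachable n m) (c : X) :
    IsDivergence G (Pi.single n c - Pi.single m c : Q → X) := by
  obtain ⟨p⟩ := h
  induction p with
  | nil => simpa using isDivergence_zero
  | cons h _ ih =>
    have := (isDivergence_single_sub_single_of_adj h c).add ih
    rwa [sub_add_sub_cancel] at this

/-- On a connected graph every balanced family is the divergence of an antisymmetric flow. -/
theorem isDivergence_of_sum_eq_zero (hG : G.Connected) {b : Q → X} (hb : ∑ n, b n = 0) :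
    IsDivergence G b := by
  obtain ⟨r⟩ := hG.nonempty
  -- Route every `b n` to a root `r`; the amounts collected there cancel because `b` is balanced.
  have h : b = ∑ n, (Pi.single n (b n) - Pi.single r (b n) : Q → X) := by
    rw [Finset.sum_sub_distrib, Finset.univ_sum_single]
    have : ∑ n, (Pi.single r (b n) : Q → X) = Pi.single r (∑ n, b n) := by
      ext k
      rcases eq_or_ne k r with rfl | hk
      · simp
      · simp [hk]
    rw [this, hb, Pi.single_zero, sub_zero]
  rw [h]
  refine Finset.sum_induction _ (IsDivergence G) (fun _ _ => IsDivergence.add) isDivergence_zero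
    fun n _ => isDivergence_single_sub_single (hG.preconnected n r) _

theorem eq_of_connected_of_forall_adj {α V : Type*} {G : SimpleGraph V} (hG : G.Connected) {x : V → α}
    (h : ∀ n m, G.Adj n m → x n = x m) (n m : V) : x n = x m := by
  obtain ⟨p⟩ := hG.preconnected n m
  induction p with
  | nil => rfl
  | cons hadj _ ih => exact (h _ _ hadj).trans ih

theorem norm_sum_add_sq_le {D : Type*} (J : Finset D) (u : D → X) (y : X) :
    ‖∑ d ∈ J, u d + y‖ ^ 2 ≤ (J.card + 1) * (∑ d ∈ J, ‖u d‖ ^ 2 + ‖y‖ ^ 2) := by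
  have h1 : ‖∑ d ∈ J, u d + y‖ ≤ ∑ d ∈ J, ‖u d‖ + ‖y‖ :=
    (norm_add_le _ _).trans (add_le_add_left (norm_sum_le _ _) _)
  have h2 : (∑ d ∈ J, ‖u d‖) ^ 2 ≤ J.card * ∑ d ∈ J, ‖u d‖ ^ 2 := sq_sum_le_card_mul_sum_sq
  have h3 : 0 ≤ ∑ d ∈ J, ‖u d‖ ^ 2 := Finset.sum_nonneg fun d _ => sq_nonneg _
  refine (pow_le_pow_left₀ (norm_nonneg _) h1 2).trans ?_
  set A := ∑ d ∈ J, ‖u d‖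
  set S := ∑ d ∈ J, ‖u d‖ ^ 2
  set k : ℝ := ((J.card : ℕ) : ℝ)
  have hk : 0 ≤ k := Nat.cast_nonneg _
  rcases hk.eq_or_lt with hk0 | hk0
  · rw [← hk0, zero_mul] at h2
    have : A = 0 := pow_eq_zero_iff two_ne_zero |>.1 (le_antisymm h2 (sq_nonneg _))
    rw [this, ← hk0]
    nlinarith
  · have h4 : k * (2 * A * ‖y‖) ≤ k * (S + k * ‖y‖ ^ 2) := by nlinarith [sq_nonneg (A - k * ‖y‖)]
    have h5 := le_of_mul_le_mul_left h4 hk0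
    nlinarith

variable [InnerProductSpace ℝ X] [FiniteDimensional ℝ X]

theorem adjoint_edgeOp_edgeOp (w : PiLp 2 fun _ : Q => X) :
    LinearMap.adjoint (edgeOp G X) (edgeOp G X w) =
      WithLp.toLp 2 fun n => ((Finset.univ.filter fun d : G.Dart => d.fst = n).card : ℝ) • w n := by
  refine ext_inner_left ℝ fun z => ?_
  rw [LinearMap.adjoint_inner_right, PiLp.inner_apply, PiLp.inner_apply,
    ← Finset.sum_fiberwise Finset.univ (fun d : G.Dart => d.fst)]
  refine Finset.sum_congr rfl fun n _ => ?_
  have h : ∀ d ∈ Finset.univ.filter fun d : G.Dart => d.fst = n,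
      inner ℝ (edgeOp G X z d) (edgeOp G X w d) = inner ℝ (z n) (w n) := by
    intro d hd
    rw [← (Finset.mem_filter.1 hd).2]
    rfl
  rw [Finset.sum_congr rfl h, Finset.sum_const, real_inner_smul_right, nsmul_eq_mul]

/-- `DᵀD` multiplies block `n` by its degree, so `Dw` with `w` supported at `n` is an eigenvector of
`DDᵀ` for that degree. The neighbour `m` ensures `Dw ≠ 0`. -/
theorem card_dart_fst_le_lambdaMax [Nontrivial X] {n m : Q} (h : G.Adj n m) :
    ((Finset.univ.filter fun d : G.Dart => d.fst = n).card : ℝ) ≤ lambdaMax (edgeGram G X) := by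
  obtain ⟨x, hx⟩ := exists_ne (0 : X)
  let w : PiLp 2 fun _ : Q => X := WithLp.toLp 2 (Pi.single n x)
  refine le_csSup (Module.End.finite_hasEigenvalue (edgeGram G X)).bddAbove ?_
  refine Module.End.hasEigenvalue_of_hasEigenvector (x := edgeOp G X w)
    ⟨Module.End.mem_eigenspace_iff.2 ?_, fun h0 => hx ?_⟩
  · rw [edgeGram, LinearMap.comp_apply, adjoint_edgeOp_edgeOp, ← map_smul]
    congr 1
    ext k
    rcases eq_or_ne k n with rfl | hk
    · rfl
    · simp [w, hk]
  · have := congrArg (fun v : PiLp 2 fun _ : G.Dart => X => v ⟨(n, m), h⟩) h0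
    have h' : (Pi.single n x : Q → X) n = 0 := this
    rwa [Pi.single_eq_same] at h'

/-- The step size bound `λ (deg n + 1) ≤ 1`, in the form in which it is used. -/
theorem smul_norm_nodeSum_add_sq_le (hQ : 1 < Fintype.card Q) (hG : G.Connected) {lam : ℝ}
    (hlam_pos : 0 < lam) (hlam_le : lam ≤ 1 / (lambdaMax (edgeGram G X) + 1))
    (v : G.Dart → X) (y : X) (n : Q) :
    lam * ‖nodeSum v n + y‖ ^ 2 ≤ ∑ d : G.Dart with d.fst = n, ‖v d‖ ^ 2 + ‖y‖ ^ 2 := by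
  have hS : 0 ≤ ∑ d : G.Dart with d.fst = n, ‖v d‖ ^ 2 + ‖y‖ ^ 2 := by positivity
  rcases subsingleton_or_nontrivial X with hX | hX
  · rw [Subsingleton.elim (nodeSum v n + y) 0]
    simpa using hS
  have : Nontrivial Q := Fintype.one_lt_card_iff_nontrivial.1 hQ
  obtain ⟨m, hm⟩ := hG.preconnected.exists_adj_of_nontrivial n
  have h1 := norm_sum_add_sq_le (Finset.univ.filter fun d : G.Dart => d.fst = n) v y
  have h2 := card_dart_fst_le_lambdaMax (X := X) hm
  have h3 : lam * ((Finset.univ.filter fun d : G.Dart => d.fst = n).card + 1) ≤ 1 := by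
    have hc : (0 : ℝ) ≤ (Finset.univ.filter fun d : G.Dart => d.fst = n).card := Nat.cast_nonneg _
    rw [le_div_iff₀ (by linarith)] at hlam_le
    nlinarith
  calc lam * ‖nodeSum v n + y‖ ^ 2 ≤ _ := mul_le_mul_of_nonneg_left h1 hlam_pos.le
    _ ≤ _ := by
      rw [← mul_assoc]
      exact mul_le_of_le_one_left hS h3

end Network

/-! ### Optimality conditions for the sum problem -/

section Optimality

open Set

variable {X : Type*} [NormedAddCommGroup X] [InnerProductSpace ℝ X]
  {Q : Type*} [Fintype Q] {f : Q → X → ℝ} {g : Q → X → EReal}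

theorem objective_eq_coe (hg : ∀ n, IsGammaZero (g n)) {z : X} (hz : ∀ n, z ∈ effDom (g n)) :
    objective f g z = ((∑ n, (f n z + (g n z).toReal) : ℝ) : EReal) := by
  have h : ∀ n, (f n z : EReal) + g n z = ((f n z + (g n z).toReal : ℝ) : EReal) := fun n => by
    rw [EReal.coe_add, (hg n).coe_toReal (hz n)]
  rw [objective, Finset.sum_congr rfl fun n _ => h n]
  let c : ℝ →+ EReal := ⟨⟨fun r => (r : EReal), EReal.coe_zero⟩, EReal.coe_add⟩
  exact (map_sum c _ _).symm

theorem objective_eq_top (hg : ∀ n, IsGammaZero (g n)) {z : X} {n : Q} (hz : z ∉ effDom (g n)) :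
    objective f g z = ⊤ := by
  classical
  have hn : g n z = ⊤ := not_lt_top_iff.1 hz
  have hbot : ∀ m, (f m z : EReal) + g m z ≠ ⊥ := fun m h =>
    (EReal.add_eq_bot_iff.1 h).elim (EReal.coe_ne_bot _) ((hg m).ne_bot z)
  rw [objective, ← Finset.add_sum_erase _ _ (Finset.mem_univ n), hn, EReal.coe_add_top]
  refine EReal.top_add_of_ne_bot (Finset.sum_induction _ (· ≠ ⊥) (fun a b ha hb h => ?_)
    EReal.zero_ne_bot fun m _ => hbot m)
  exact (EReal.add_eq_bot_iff.1 h).elim ha hb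

variable [FiniteDimensional ℝ X]

theorem isSolution_of_sum_eq_zero (hconv : ∀ n, ConvexOn ℝ univ (f n))
    (hdiff : ∀ n, Differentiable ℝ (f n)) (hg : ∀ n, IsGammaZero (g n)) {xs : X} {u : Q → X}
    (hu : ∀ n, IsSubgradient (g n) xs (u n)) (hsum : ∑ n, (grad (f n) xs + u n) = 0) :
    IsSolution f g xs := by
  intro z _
  change objective f g xs ≤ objective f g z
  by_cases hz : ∀ n, z ∈ effDom (g n)
  · rw [objective_eq_coe hg fun n => (hu n).1, objective_eq_coe hg hz, EReal.coe_le_coe_iff]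
    have h : ∑ n, inner ℝ (grad (f n) xs + u n) (z - xs) = 0 := by
      rw [← sum_inner, hsum, inner_zero_left]
    rw [← add_zero (∑ n, (f n xs + (g n xs).toReal)), ← h, ← Finset.sum_add_distrib]
    refine Finset.sum_le_sum fun n _ => ?_
    have h1 := add_inner_grad_le (hconv n) (hdiff n) xs z
    have h2 := (hu n).2 z (hz n)
    rw [inner_add_left]
    linarith
  · obtain ⟨n, hn⟩ := not_forall.1 hz
    rw [objective_eq_top hg hn]
    exact le_top

/-- A solution also minimizes the problem with each `fₙ` linearized there: by the descent lemma the
error along a segment is of second order. The sum rule then applies to `gₙ` plus a linear form. -/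
theorem IsSolution.exists_sum_eq_zero {L : ℝ}
    (hdiff : ∀ n, Differentiable ℝ (f n))
    (hlip : ∀ n x z, ‖grad (f n) x - grad (f n) z‖ ≤ L * ‖x - z‖) (hg : ∀ n, IsGammaZero (g n))
    (hri : (⋂ n, intrinsicInterior ℝ (effDom (g n))).Nonempty) {xs : X}
    (hxs : IsSolution f g xs) :
    ∃ u : Q → X, (∀ n, IsSubgradient (g n) xs (u n)) ∧ ∑ n, (grad (f n) xs + u n) = 0 := by
  classical
  obtain ⟨z₀, hz₀⟩ := hri
  replace hz₀ := mem_iInter.1 hz₀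
  have hmin : ∀ z, objective f g xs ≤ objective f g z := fun z => hxs (mem_univ z)
  have hxs_dom : ∀ n, xs ∈ effDom (g n) := by
    intro n
    by_contra hn
    have h := hmin z₀
    rw [objective_eq_top hg hn,
      objective_eq_coe hg fun m => intrinsicInterior_subset (hz₀ m), top_le_iff] at h
    exact EReal.coe_ne_top _ h
  have hlin : ∀ z, (∀ n, z ∈ effDom (g n)) →
      ∑ n, ((g n xs).toReal + inner ℝ (grad (f n) xs) xs)
        ≤ ∑ n, ((g n z).toReal + inner ℝ (grad (f n) xs) z) := by
    intro z hz
    have key := nonneg_of_forall_add_mul_nonneg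
      (A := ∑ n, ((g n z).toReal - (g n xs).toReal + inner ℝ (grad (f n) xs) (z - xs)))
      (C := ∑ _n : Q, L / 2 * ‖z - xs‖ ^ 2) fun t ht0 ht1 => ?_
    · rw [← sub_nonneg, ← Finset.sum_sub_distrib]
      refine key.trans_eq (Finset.sum_congr rfl fun n _ => ?_)
      rw [inner_sub_right]
      ring
    · have hdom : ∀ n, (1 - t) • xs + t • z ∈ effDom (g n) := fun n =>
        (hg n).convexOn.1 (hxs_dom n) (hz n) (sub_nonneg.2 ht1) ht0.le (sub_add_cancel 1 t)
      have h1 := hmin ((1 - t) • xs + t • z)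
      rw [objective_eq_coe hg hxs_dom, objective_eq_coe hg hdom, EReal.coe_le_coe_iff,
        ← sub_nonneg, ← Finset.sum_sub_distrib] at h1
      have h2 : ∑ n, (f n ((1 - t) • xs + t • z) + (g n ((1 - t) • xs + t • z)).toReal
          - (f n xs + (g n xs).toReal)) ≤
          t * (∑ n, ((g n z).toReal - (g n xs).toReal + inner ℝ (grad (f n) xs) (z - xs))
            + t * ∑ _n : Q, L / 2 * ‖z - xs‖ ^ 2) := by
        rw [Finset.mul_sum _ _ t, ← Finset.sum_add_distrib, Finset.mul_sum]
        refine Finset.sum_le_sum fun n _ => ?_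
        have h3 := le_add_inner_grad_add (hdiff n) (hlip n) xs (t • (z - xs))
        have h4 : xs + t • (z - xs) = (1 - t) • xs + t • z := by module
        rw [h4, real_inner_smul_right, norm_smul, Real.norm_of_nonneg ht0.le] at h3
        have h5 := (hg n).convexOn.2 (hxs_dom n) (hz n) (sub_nonneg.2 ht1) ht0.le
          (sub_add_cancel 1 t)
        simp only [smul_eq_mul] at h5
        nlinarith
      exact nonneg_of_mul_nonneg_right (h1.trans h2) ht0
  obtain ⟨u, hu_sum, hu⟩ := exists_sum_eq_zero_of_isMinOn_sum
    (h := fun n z => (g n z).toReal + inner ℝ (grad (f n) xs) z)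
    (fun n => (hg n).convexOn.add
      ((innerₛₗ ℝ (grad (f n) xs)).convexOn (hg n).convexOn.1)) hxs_dom hz₀ hlin
  refine ⟨fun n => u n - grad (f n) xs, fun n => ⟨hxs_dom n, fun z hz => ?_⟩, by simpa using hu_sum⟩
  have := hu n z hz
  simp only [inner_sub_left, inner_sub_right] at this ⊢
  linarith

end Optimality

/-! ### Fixed points of the full iteration -/

section Operator

variable {X : Type*} [NormedAddCommGroup X] [InnerProductSpace ℝ X]
  {Q : Type*} [Fintype Q] [DecidableEq Q] {G : SimpleGraph Q} [DecidableRel G.Adj]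

/-- `∑_{m ∼ n} v_{{n,m}}(n) + yₙ`, through which the dual variables of agent `n` act on `xₙ`. -/
def dualSum (s : State G X) (n : Q) : X := nodeSum s.v n + s.y n

variable [FiniteDimensional ℝ X] (f : Q → X → ℝ) (g : Q → X → EReal) (γ lam : ℝ)

/-- One iteration in which every agent is active. -/
noncomputable def fullStep (s : State G X) : State G X :=
  ⟨newV f γ lam s, newY f g γ lam s, newX f g γ lam s⟩

variable {f g γ lam}

theorem localValue_eq (s : State G X) (n : Q) :
    localValue f γ lam s n = gradStep f γ s n - lam • dualSum s n := by
  rw [localValue, dualSum, smul_add]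
  abel

theorem newY_eq (s : State G X) (n : Q) :
    newY f g γ lam s n = (localValue f γ lam s n + s.y n)
      - prox (fun z => ((γ / lam : ℝ) : EReal) * g n z) (localValue f γ lam s n + s.y n) := by
  have h : gradStep f γ s n + (1 - lam) • s.y n - lam • nodeSum s.v n
      = localValue f γ lam s n + s.y n := by
    rw [localValue]
    module
  simp only [newY, h]

theorem newX_eq (s : State G X) (n : Q) :
    newX f g γ lam s n = gradStep f γ s n - lam • dualSum (fullStep f g γ lam s) n := by
  rw [newX, dualSum, smul_add, fullStep]
  abel

theorem newV_symm (s : State G X) (d : G.Dart) :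
    newV f γ lam s d.symm = -newV f γ lam s d := by
  have h1 : d.symm.fst = d.snd := rfl
  have h2 : d.symm.snd = d.fst := rfl
  rw [newV, newV, h1, h2, SimpleGraph.Dart.symm_symm]
  module

/-- `dualSum` at `n` involves only variables held by `n`, so the other agents' activity is
irrelevant. -/
theorem dualSum_step_of_mem {B : Finset Q} {n : Q} (hn : n ∈ B) (s : State G X) :
    dualSum (step f g γ lam B s) n = dualSum (fullStep f g γ lam s) n := by
  have h : nodeSum (step f g γ lam B s).v n = nodeSum (newV f γ lam s) n :=
    Finset.sum_congr rfl fun d hd => if_pos ((Finset.mem_filter.1 hd).2.symm ▸ hn)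
  have h' : (step f g γ lam B s).y n = newY f g γ lam s n := if_pos hn
  rw [dualSum, dualSum, h, h']
  rfl

/-- The edge equations give an antisymmetric `v` and equal `x` across each edge, hence consensus.
The `y`-equation makes `(λ/γ) yₙ` a subgradient of `gₙ`, and summing the `x`-equations removes the
flow. -/
theorem exists_isSolution_of_fullStep_eq (hG : G.Connected) (hγ : 0 < γ) (hlam : 0 < lam)
    (hconv : ∀ n, ConvexOn ℝ Set.univ (f n)) (hdiff : ∀ n, Differentiable ℝ (f n))
    (hg : ∀ n, IsGammaZero (g n)) {s : State G X} (hs : fullStep f g γ lam s = s) :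
    ∃ xs, IsSolution f g xs ∧ ∀ n, s.x n = xs := by
  have hc : 0 < γ / lam := div_pos hγ hlam
  have hv : ∀ d, newV f γ lam s d = s.v d := fun d => congrFun (congrArg State.v hs) d
  have hy : ∀ n, newY f g γ lam s n = s.y n := fun n => congrFun (congrArg State.y hs) n
  have hx : ∀ n, localValue f γ lam s n = s.x n := fun n => by
    rw [localValue_eq]
    rw [← congrFun (congrArg State.x hs) n]
    change _ = newX f g γ lam s n
    rw [newX_eq, hs]
  have hanti : ∀ d, s.v d.symm = -s.v d := fun d => by rw [← hv, ← hv, newV_symm]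
  have hadj : ∀ n m, G.Adj n m → s.x n = s.x m := by
    intro n m h
    have h1 := hv ⟨(n, m), h⟩
    rw [newV, hanti, hx, hx] at h1
    have h2 : (1 / 2 : ℝ) • (s.x n - s.x m) = 0 := by
      have h3 : (1 / 2 : ℝ) • (s.v ⟨(n, m), h⟩ - -s.v ⟨(n, m), h⟩) = s.v ⟨(n, m), h⟩ := by module
      rw [h3] at h1
      exact add_eq_right.1 h1
    exact sub_eq_zero.1 ((smul_eq_zero.1 h2).resolve_left (by norm_num))
  obtain ⟨r⟩ := hG.nonempty
  have hxr : ∀ n, s.x n = s.x r := fun n => eq_of_connected_of_forall_adj hG hadj n r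
  refine ⟨s.x r, isSolution_of_sum_eq_zero hconv hdiff hg
    (u := fun n => (γ / lam)⁻¹ • s.y n) (fun n => ?_) ?_, hxr⟩
  · rw [← isSubgradient_const_mul_iff hc (hg n)]
    have h1 := newY_eq (f := f) (g := g) (γ := γ) (lam := lam) s n
    rw [hy, hx, hxr] at h1
    have h2 := ((hg n).const_mul hc).isSubgradient_prox (s.x r + s.y n)
    have h3 : prox (fun z => ((γ / lam : ℝ) : EReal) * g n z) (s.x r + s.y n) = s.x r := by
      have := sub_eq_iff_eq_add.1 h1.symm
      exact (add_left_cancel ((add_comm _ _).trans this)).symm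
    rwa [h3, add_sub_cancel_left] at h2
  · have h1 : ∀ n, γ • (grad (f n) (s.x r) + (γ / lam)⁻¹ • s.y n) = -(lam • nodeSum s.v n) := by
      intro n
      have h2 := hx n
      rw [localValue, gradStep, hxr, sub_sub, sub_sub, sub_eq_self] at h2
      have h3 : γ * (γ / lam)⁻¹ = lam := by field_simp
      rw [smul_add, smul_smul, h3, ← add_eq_zero_iff_eq_neg, ← h2]
      abel
    have h2 : γ • ∑ n, (grad (f n) (s.x r) + (γ / lam)⁻¹ • s.y n) = 0 := by
      rw [Finset.smul_sum, Finset.sum_congr rfl fun n _ => h1 n, Finset.sum_neg_distrib,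
        ← Finset.smul_sum, sum_nodeSum, sum_eq_zero_of_antisymm hanti, smul_zero, neg_zero]
    exact (smul_eq_zero.1 h2).resolve_left hγ.ne'

theorem exists_fullStep_eq {L : ℝ} (hG : G.Connected) (hγ : 0 < γ) (hlam : 0 < lam)
    (hdiff : ∀ n, Differentiable ℝ (f n))
    (hlip : ∀ n x z, ‖grad (f n) x - grad (f n) z‖ ≤ L * ‖x - z‖)
    (hg : ∀ n, IsGammaZero (g n)) (hmin : ∃ x, IsSolution f g x)
    (hri : (⋂ n, intrinsicInterior ℝ (effDom (g n))).Nonempty) :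
    ∃ s : State G X, fullStep f g γ lam s = s := by
  have hc : 0 < γ / lam := div_pos hγ hlam
  obtain ⟨xs, hxs⟩ := hmin
  obtain ⟨u, hu, hsum⟩ := hxs.exists_sum_eq_zero hdiff hlip hg hri
  obtain ⟨v, hv_anti, hv⟩ := isDivergence_of_sum_eq_zero hG
    (b := fun n => -((γ / lam) • (grad (f n) xs + u n)))
    (by rw [Finset.sum_neg_distrib, ← Finset.smul_sum, hsum, smul_zero, neg_zero])
  -- The factor `γ / λ` makes `λ · dualSum` cancel the gradient step, so every `localValue` equals
  -- `xs`.
  let s : State G X := ⟨v, fun n => (γ / lam) • u n, fun _ => xs⟩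
  have hdual : ∀ n, lam • dualSum s n = -(γ • grad (f n) xs) := fun n => by
    have h1 : dualSum s n = -((γ / lam) • grad (f n) xs) := by
      change nodeSum v n + (γ / lam) • u n = _
      rw [hv]
      module
    rw [h1, smul_neg, smul_smul, mul_div_cancel₀ _ hlam.ne']
  have hlocal : ∀ n, localValue f γ lam s n = xs := fun n => by
    rw [localValue_eq, hdual, gradStep]
    change xs - γ • grad (f n) xs - _ = xs
    abel
  have hv' : newV f γ lam s = v := by
    ext d
    rw [newV, hlocal, hlocal]
    change _ + (1 / 2 : ℝ) • (v d - v d.symm) = v d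
    rw [hv_anti]
    module
  have hy' : newY f g γ lam s = s.y := by
    ext n
    rw [newY_eq, hlocal, ((hg n).const_mul hc).prox_add_eq, add_sub_cancel_left]
    rw [isSubgradient_const_mul_iff hc (hg n), inv_smul_smul₀ hc.ne']
    exact hu n
  have hdual' : ∀ n, dualSum (fullStep f g γ lam s) n = dualSum s n := fun n => by
    rw [dualSum, dualSum, fullStep, hv', hy']
  refine ⟨s, State.ext hv' hy' (funext fun n => ?_)⟩
  change newX f g γ lam s n = xs
  rw [newX_eq, hdual', ← localValue_eq, hlocal]

end Operator

/-! ### Energy decrease in the block diagonal metric -/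

section Energy

variable {X : Type*} [NormedAddCommGroup X]

/-- Pure expansion of squares for one agent. It isolates the last bracket, whose edge part will
cancel over the graph and whose `y` part is nonnegative by firm nonexpansiveness. -/
theorem block_energy_eq [InnerProductSpace ℝ X] {D : Type*} (J : Finset D) (u u' : D → X) (y y' p : X) (lam : ℝ) :
    lam * (∑ d ∈ J, ‖u' d‖ ^ 2 + ‖y'‖ ^ 2) + ‖p - lam • (∑ d ∈ J, u' d + y')‖ ^ 2 =
      ‖p‖ ^ 2 + lam * (∑ d ∈ J, ‖u d‖ ^ 2 + ‖y‖ ^ 2) - lam ^ 2 * ‖∑ d ∈ J, u d + y‖ ^ 2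
      - lam * (∑ d ∈ J, ‖u' d - u d‖ ^ 2 + ‖y' - y‖ ^ 2
        - lam * ‖(∑ d ∈ J, u' d + y') - (∑ d ∈ J, u d + y)‖ ^ 2)
      - 2 * lam * (∑ d ∈ J, (inner ℝ (u' d) (p - lam • (∑ d ∈ J, u d + y) + u d) - ‖u' d‖ ^ 2)
        + (inner ℝ y' (p - lam • (∑ d ∈ J, u d + y) + y) - ‖y'‖ ^ 2)) := by
  have h1 : ∑ d ∈ J, ‖u' d - u d‖ ^ 2
      = ∑ d ∈ J, ‖u' d‖ ^ 2 - 2 * ∑ d ∈ J, inner ℝ (u' d) (u d) + ∑ d ∈ J, ‖u d‖ ^ 2 := by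
    simp only [norm_sub_sq_real, Finset.sum_add_distrib, Finset.sum_sub_distrib, Finset.mul_sum]
  set b := ∑ d ∈ J, u d + y
  have h2 : ∑ d ∈ J, (inner ℝ (u' d) (p - lam • b + u d) - ‖u' d‖ ^ 2)
      = inner ℝ (∑ d ∈ J, u' d) (p - lam • b) + ∑ d ∈ J, inner ℝ (u' d) (u d)
        - ∑ d ∈ J, ‖u' d‖ ^ 2 := by
    simp only [inner_add_right, Finset.sum_add_distrib, Finset.sum_sub_distrib, sum_inner]
  have h3 : inner ℝ (∑ d ∈ J, u' d) (p - lam • b)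
      = inner ℝ (∑ d ∈ J, u' d + y') (p - lam • b) - inner ℝ y' (p - lam • b) := by
    rw [inner_add_left]
    ring
  rw [h1, h2, h3, inner_add_right y']
  set b' := ∑ d ∈ J, u' d + y'
  rw [norm_sub_sq_real y', norm_sub_sq_real b', norm_sub_sq_real p, norm_smul, mul_pow,
    Real.norm_eq_abs, sq_abs, inner_sub_right b', real_inner_smul_right, real_inner_smul_right,
    real_inner_comm p b']
  ring

variable {Q : Type*} [Fintype Q] [DecidableEq Q] {G : SimpleGraph Q} [DecidableRel G.Adj]

/-- The squared distance between the variables that agent `n` holds in two states. -/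
def blockDist (lam : ℝ) (n : Q) (a s : State G X) : ℝ :=
  lam * (∑ d : G.Dart with d.fst = n, ‖s.v d - a.v d‖ ^ 2 + ‖s.y n - a.y n‖ ^ 2)
    + ‖s.x n - a.x n‖ ^ 2

theorem dualSum_sub (s a : State G X) (n : Q) :
    dualSum s n - dualSum a n
      = ∑ d : G.Dart with d.fst = n, (s.v d - a.v d) + (s.y n - a.y n) := by
  rw [Finset.sum_sub_distrib]
  simp only [dualSum, nodeSum]
  abel

theorem blockDist_nonneg {lam : ℝ} (hlam : 0 < lam) (n : Q) (a s : State G X) : 0 ≤ blockDist lam n a s := by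
  unfold blockDist
  positivity

variable [InnerProductSpace ℝ X] [FiniteDimensional ℝ X] {f : Q → X → ℝ} {g : Q → X → EReal} {β γ lam : ℝ}

variable (f g β γ lam) in
/-- The decrease of the energy of agent `n` in a full iteration. -/
noncomputable def blockGap (n : Q) (a s : State G X) : ℝ :=
  γ * (2 * β - γ) * ‖grad (f n) (s.x n) - grad (f n) (a.x n)‖ ^ 2
    + lam ^ 2 * ‖dualSum s n - dualSum a n‖ ^ 2
    + lam * (∑ d : G.Dart with d.fst = n, ‖newV f γ lam s d - s.v d‖ ^ 2
        + ‖newY f g γ lam s n - s.y n‖ ^ 2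
      - lam * ‖dualSum (fullStep f g γ lam s) n - dualSum s n‖ ^ 2)

theorem metric_gap_nonneg (hQ : 1 < Fintype.card Q) (hG : G.Connected) (hlam_pos : 0 < lam)
    (hlam_le : lam ≤ 1 / (lambdaMax (edgeGram G X) + 1)) (n : Q) (s : State G X) :
    0 ≤ ∑ d : G.Dart with d.fst = n, ‖newV f γ lam s d - s.v d‖ ^ 2
        + ‖newY f g γ lam s n - s.y n‖ ^ 2
      - lam * ‖dualSum (fullStep f g γ lam s) n - dualSum s n‖ ^ 2 := by
  have h := smul_norm_nodeSum_add_sq_le hQ hG hlam_pos hlam_le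
    (fun d => newV f γ lam s d - s.v d) (newY f g γ lam s n - s.y n) n
  rw [dualSum_sub]
  exact sub_nonneg.2 h

theorem sum_blockDist_fullStep_le (hβ : 0 < β) (hγ : 0 < γ) (hlam : 0 < lam)
    (hconv : ∀ n, ConvexOn ℝ Set.univ (f n)) (hdiff : ∀ n, Differentiable ℝ (f n))
    (hlip : ∀ n x z, ‖grad (f n) x - grad (f n) z‖ ≤ 1 / β * ‖x - z‖)
    (hg : ∀ n, IsGammaZero (g n)) {a : State G X} (ha : fullStep f g γ lam a = a)
    (s : State G X) :
    ∑ n, blockDist lam n a (fullStep f g γ lam s)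
      ≤ ∑ n, blockDist lam n a s - ∑ n, blockGap f g β γ lam n a s := by
  have hc : 0 < γ / lam := div_pos hγ hlam
  have hav : ∀ d, a.v d = newV f γ lam a d := fun d => (congrFun (congrArg State.v ha) d).symm
  have hay : ∀ n, a.y n = newY f g γ lam a n := fun n => (congrFun (congrArg State.y ha) n).symm
  have hax : ∀ n, a.x n = newX f g γ lam a n := fun n => (congrFun (congrArg State.x ha) n).symm
  let p : Q → X := fun n => gradStep f γ s n - gradStep f γ a n
  have hlocal : ∀ n, localValue f γ lam s n - localValue f γ lam a n
      = p n - lam • (dualSum s n - dualSum a n) := fun n => by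
    rw [localValue_eq, localValue_eq, smul_sub]
    simp only [p]
    abel
  let w : G.Dart → X := fun d => newV f γ lam s d - a.v d
  let e : G.Dart → ℝ := fun d =>
    inner ℝ (w d) (p d.fst - lam • (dualSum s d.fst - dualSum a d.fst) + (s.v d - a.v d))
      - ‖w d‖ ^ 2
  have hw : ∀ d, w d.symm = -w d := fun d => by
    simp only [w, hav, newV_symm]
    abel
  -- After absorbing `‖w d‖²`, the second factor of the inner product is symmetric under reversal
  -- while `w` is antisymmetric.
  have he_sum : ∑ d, e d = 0 := by
    refine sum_eq_zero_of_antisymm fun d => ?_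
    have h1 : ∀ d, e d = inner ℝ (w d) ((1 / 2 : ℝ) •
        ((localValue f γ lam s d.fst - localValue f γ lam a d.fst)
          + (localValue f γ lam s d.snd - localValue f γ lam a d.snd)
          + (s.v d - a.v d) + (s.v d.symm - a.v d.symm))) := by
      intro d
      simp only [e]
      rw [← hlocal, ← real_inner_self_eq_norm_sq, ← inner_sub_right]
      congr 1
      have h2 : w d = newV f γ lam s d - newV f γ lam a d := by simp only [w, hav d]
      rw [h2, newV, newV]
      module
    rw [h1, h1, hw, inner_neg_left, SimpleGraph.Dart.symm_symm]
    congr 2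
    have h1 : d.symm.fst = d.snd := rfl
    have h2 : d.symm.snd = d.fst := rfl
    rw [h1, h2]
    module
  have hy : ∀ n, 0 ≤ inner ℝ (newY f g γ lam s n - a.y n)
      (p n - lam • (dualSum s n - dualSum a n) + (s.y n - a.y n))
        - ‖newY f g γ lam s n - a.y n‖ ^ 2 := by
    intro n
    have h1 := ((hg n).const_mul hc).norm_sub_prox_sub_sq_le
      (localValue f γ lam s n + s.y n) (localValue f γ lam a n + a.y n)
    rw [← newY_eq, ← newY_eq, ← hay, add_sub_add_comm, hlocal] at h1
    exact sub_nonneg.2 h1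
  have hblock : ∀ n, blockDist lam n a (fullStep f g γ lam s) =
      blockDist lam n a s - blockGap f g β γ lam n a s
      + (‖p n‖ ^ 2 - (‖s.x n - a.x n‖ ^ 2
        - γ * (2 * β - γ) * ‖grad (f n) (s.x n) - grad (f n) (a.x n)‖ ^ 2))
      - 2 * lam * (∑ d : G.Dart with d.fst = n, e d + (inner ℝ (newY f g γ lam s n - a.y n)
      (p n - lam • (dualSum s n - dualSum a n) + (s.y n - a.y n))
        - ‖newY f g γ lam s n - a.y n‖ ^ 2)) := by
    intro n
    have h1 := block_energy_eq (Finset.univ.filter fun d : G.Dart => d.fst = n)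
      (fun d => s.v d - a.v d) w (s.y n - a.y n) (newY f g γ lam s n - a.y n) (p n) lam
    have h2 : ∑ d : G.Dart with d.fst = n, w d + (newY f g γ lam s n - a.y n)
        = dualSum (fullStep f g γ lam s) n - dualSum a n := 
      (dualSum_sub (fullStep f g γ lam s) a n).symm
    have h3 : newX f g γ lam s n - a.x n
        = p n - lam • (dualSum (fullStep f g γ lam s) n - dualSum a n) := by
      rw [hax, newX_eq, newX_eq, ha, smul_sub]
      simp only [p]
      abel
    have h4 : ∑ d : G.Dart with d.fst = n, e d = ∑ d : G.Dart with d.fst = n,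
        (inner ℝ (w d) (p n - lam • (dualSum s n - dualSum a n) + (s.v d - a.v d))
          - ‖w d‖ ^ 2) :=
      Finset.sum_congr rfl fun d hd => by
        simp only [e, (Finset.mem_filter.1 hd).2]
    rw [h2, ← dualSum_sub, sub_sub_sub_cancel_right, sub_sub_sub_cancel_right, ← h3, ← h4] at h1
    simp only [w, sub_sub_sub_cancel_right] at h1
    change lam * (∑ d : G.Dart with d.fst = n, ‖newV f γ lam s d - a.v d‖ ^ 2
      + ‖newY f g γ lam s n - a.y n‖ ^ 2) + ‖newX f g γ lam s n - a.x n‖ ^ 2 = _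
    rw [h1]
    simp only [blockDist, blockGap]
    ring
  have hle : ∀ n, blockDist lam n a (fullStep f g γ lam s) ≤
      blockDist lam n a s - blockGap f g β γ lam n a s
        - 2 * lam * ∑ d : G.Dart with d.fst = n, e d := by
    intro n
    have h1 := norm_sub_smul_grad_sq_le hβ hγ (hconv n) (hdiff n) (hlip n) (s.x n) (a.x n)
    have h2 : ‖p n‖ ^ 2 ≤ ‖s.x n - a.x n‖ ^ 2
        - γ * (2 * β - γ) * ‖grad (f n) (s.x n) - grad (f n) (a.x n)‖ ^ 2 := h1
    have h3 := mul_nonneg (mul_pos two_pos hlam).le (hy n)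
    rw [hblock n, mul_add]
    linarith
  refine (Finset.sum_le_sum fun n _ => hle n).trans_eq ?_
  have h : ∑ n, ∑ d : G.Dart with d.fst = n, e d = 0 :=
    (Finset.sum_fiberwise _ _ _).trans he_sum
  rw [Finset.sum_sub_distrib, Finset.sum_sub_distrib, ← Finset.mul_sum, h, mul_zero, sub_zero]

theorem blockGap_nonneg (hQ : 1 < Fintype.card Q) (hG : G.Connected) (hγ : 0 < γ)
    (hγ_lt : γ < 2 * β) (hlam_pos : 0 < lam)
    (hlam_le : lam ≤ 1 / (lambdaMax (edgeGram G X) + 1)) (n : Q) (a s : State G X) :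
    0 ≤ blockGap f g β γ lam n a s := by
  have h1 := metric_gap_nonneg (f := f) (g := g) (γ := γ) hQ hG hlam_pos hlam_le n s
  have h2 : 0 < 2 * β - γ := sub_pos.2 hγ_lt
  unfold blockGap
  positivity

theorem eq_of_blockGap_eq_zero (hQ : 1 < Fintype.card Q) (hG : G.Connected) (hγ : 0 < γ)
    (hγ_lt : γ < 2 * β) (hlam_pos : 0 < lam)
    (hlam_le : lam ≤ 1 / (lambdaMax (edgeGram G X) + 1)) {n : Q} {a s : State G X}
    (h : blockGap f g β γ lam n a s = 0) :
    grad (f n) (s.x n) = grad (f n) (a.x n) ∧ dualSum s n = dualSum a n ∧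
      ∑ d : G.Dart with d.fst = n, ‖newV f γ lam s d - s.v d‖ ^ 2
        + ‖newY f g γ lam s n - s.y n‖ ^ 2
        = lam * ‖dualSum (fullStep f g γ lam s) n - dualSum s n‖ ^ 2 := by
  have h1 := metric_gap_nonneg (f := f) (g := g) (γ := γ) hQ hG hlam_pos hlam_le n s
  have h2 : 0 < γ * (2 * β - γ) := mul_pos hγ (sub_pos.2 hγ_lt)
  have h3 := mul_nonneg h2.le (sq_nonneg ‖grad (f n) (s.x n) - grad (f n) (a.x n)‖)
  have h4 : 0 ≤ lam ^ 2 * ‖dualSum s n - dualSum a n‖ ^ 2 := by positivity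
  have h5 := mul_nonneg hlam_pos.le h1
  unfold blockGap at h
  refine ⟨?_, ?_, ?_⟩
  · have : γ * (2 * β - γ) * ‖grad (f n) (s.x n) - grad (f n) (a.x n)‖ ^ 2 = 0 := by linarith
    simpa [h2.ne', sub_eq_zero] using this
  · have : lam ^ 2 * ‖dualSum s n - dualSum a n‖ ^ 2 = 0 := by linarith
    simpa [hlam_pos.ne', sub_eq_zero] using this
  · have : lam * (∑ d : G.Dart with d.fst = n, ‖newV f γ lam s d - s.v d‖ ^ 2
        + ‖newY f g γ lam s n - s.y n‖ ^ 2
      - lam * ‖dualSum (fullStep f g γ lam s) n - dualSum s n‖ ^ 2) = 0 := by linarith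
    exact sub_eq_zero.1 ((mul_eq_zero.1 this).resolve_left hlam_pos.ne')

/-- The dual variables enter `x` only through `dualSum`, which is block diagonal: a vanishing gap
before and after the random updates forces a fixed point. -/
theorem fullStep_eq_of_blockGap_eq_zero (hQ : 1 < Fintype.card Q) (hG : G.Connected) (hγ : 0 < γ)
    (hγ_lt : γ < 2 * β) (hlam_pos : 0 < lam)
    (hlam_le : lam ≤ 1 / (lambdaMax (edgeGram G X) + 1)) {a s : State G X}
    (ha : fullStep f g γ lam a = a) (hs : ∀ n, blockGap f g β γ lam n a s = 0)
    (hs' : ∀ n, ∃ B : Finset Q, n ∈ B ∧ blockGap f g β γ lam n a (step f g γ lam B s) = 0) :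
    fullStep f g γ lam s = s := by
  have h := fun n => eq_of_blockGap_eq_zero hQ hG hγ hγ_lt hlam_pos hlam_le (hs n)
  -- The zero gap after an update in which `n` is active pins the `dualSum` of the full step,
  -- removing the term that could offset the increments of `v` and `y`.
  have hdual : ∀ n, dualSum (fullStep f g γ lam s) n = dualSum a n := fun n => by
    obtain ⟨B, hn, hB⟩ := hs' n
    rw [← dualSum_step_of_mem hn]
    exact (eq_of_blockGap_eq_zero hQ hG hγ hγ_lt hlam_pos hlam_le hB).2.1
  have hzero : ∀ n, ∑ d : G.Dart with d.fst = n, ‖newV f γ lam s d - s.v d‖ ^ 2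
        + ‖newY f g γ lam s n - s.y n‖ ^ 2 = 0 := fun n => by
    rw [(h n).2.2, hdual, (h n).2.1]
    simp
  have hsum_nonneg : ∀ n, 0 ≤ ∑ d : G.Dart with d.fst = n, ‖newV f γ lam s d - s.v d‖ ^ 2 :=
    fun n => by positivity
  refine State.ext (funext fun d => ?_) (funext fun n => ?_) (funext fun n => ?_)
  · have h1 : ∑ e : G.Dart with e.fst = d.fst, ‖newV f γ lam s e - s.v e‖ ^ 2 = 0 := by
      nlinarith [hzero d.fst, hsum_nonneg d.fst]
    have h2 := (Finset.sum_eq_zero_iff_of_nonneg fun e _ => sq_nonneg _).1 h1 d (by simp)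
    simpa [sub_eq_zero] using! h2
  · have h1 : ‖newY f g γ lam s n - s.y n‖ ^ 2 = 0 := by
      nlinarith [hzero n, hsum_nonneg n, sq_nonneg ‖newY f g γ lam s n - s.y n‖]
    simpa [sub_eq_zero] using! h1
  -- At `a` the gradient and dual terms cancel, and both have the same values at `s`, so `x` does
  -- not move even though it may differ from `a.x`.
  · have h1 : a.x n = newX f g γ lam a n := (congrFun (congrArg State.x ha) n).symm
    rw [newX_eq, ha, gradStep, ← hdual, sub_sub, eq_comm, sub_eq_self] at h1
    change newX f g γ lam s n = s.x n
    rw [newX_eq, gradStep, (h n).1, sub_sub, h1, sub_zero]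

end Energy

/-! ### Topology of the state space, continuity and compactness -/

section StateTopology

open Filter Topology

variable {X : Type*} [NormedAddCommGroup X] {Q : Type*} {G : SimpleGraph Q}

/-- A state as a triple of families. -/
def State.equivProd : State G X ≃ (G.Dart → X) × (Q → X) × (Q → X) where
  toFun s := (s.v, s.y, s.x)
  invFun t := ⟨t.1, t.2.1, t.2.2⟩

instance : TopologicalSpace (State G X) :=
  TopologicalSpace.induced State.equivProd inferInstance

theorem State.isInducing_equivProd :
    IsInducing (State.equivProd : State G X → (G.Dart → X) × (Q → X) × (Q → X)) :=
  ⟨rfl⟩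

/-- `State.equivProd` as a homeomorphism. -/
def State.homeomorphProd : State G X ≃ₜ (G.Dart → X) × (Q → X) × (Q → X) :=
  State.equivProd.toHomeomorphOfIsInducing State.isInducing_equivProd

theorem State.continuous_v (d : G.Dart) : Continuous fun s : State G X => s.v d :=
  (continuous_apply d).comp (continuous_fst.comp State.isInducing_equivProd.continuous)

theorem State.continuous_y (n : Q) : Continuous fun s : State G X => s.y n :=
  (continuous_apply n).comp
    (continuous_fst.comp (continuous_snd.comp State.isInducing_equivProd.continuous))

theorem State.continuous_x (n : Q) : Continuous fun s : State G X => s.x n :=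
  (continuous_apply n).comp
    (continuous_snd.comp (continuous_snd.comp State.isInducing_equivProd.continuous))

theorem State.continuous_mk {α : Type*} [TopologicalSpace α] {v : α → G.Dart → X}
    {y x : α → Q → X} (hv : ∀ d, Continuous fun a => v a d) (hy : ∀ n, Continuous fun a => y a n)
    (hx : ∀ n, Continuous fun a => x a n) :
    Continuous fun a => (⟨v a, y a, x a⟩ : State G X) :=
  State.isInducing_equivProd.continuous_iff.2
    ((continuous_pi hv).prodMk ((continuous_pi hy).prodMk (continuous_pi hx)))

theorem continuous_gradStep [InnerProductSpace ℝ X] [FiniteDimensional ℝ X] {f : Q → X → ℝ}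
    {γ : ℝ} (hf : ∀ n, Continuous (grad (f n))) (n : Q) :
    Continuous fun s : State G X => gradStep f γ s n :=
  (State.continuous_x n).sub (((hf n).comp (State.continuous_x n)).const_smul γ)

variable [Fintype Q] [DecidableEq Q] [DecidableRel G.Adj]

instance : TopologicalSpace.PseudoMetrizableSpace (State G X) :=
  State.isInducing_equivProd.pseudoMetrizableSpace

theorem continuous_blockDist_left (lam : ℝ) (n : Q) (s : State G X) :
    Continuous fun a => blockDist lam n a s := by
  have h1 := State.continuous_v (G := G) (X := X)
  have h2 := State.continuous_y (G := G) (X := X)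
  have h3 := State.continuous_x (G := G) (X := X)
  unfold blockDist
  fun_prop

theorem continuous_blockDist_right (lam : ℝ) (n : Q) (a : State G X) :
    Continuous fun s => blockDist lam n a s := by
  have h1 := State.continuous_v (G := G) (X := X)
  have h2 := State.continuous_y (G := G) (X := X)
  have h3 := State.continuous_x (G := G) (X := X)
  unfold blockDist
  fun_prop

/-- The sum of the squared block distances, weighted by the inverses of `q`. -/
noncomputable def weightedDist (lam : ℝ) (q : Q → ℝ) (a s : State G X) : ℝ :=
  ∑ n, (q n)⁻¹ * blockDist lam n a s

theorem blockDist_le_weightedDist {lam : ℝ} (hlam : 0 < lam) {q : Q → ℝ} (hq : ∀ n, 0 < q n)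
    (hq_le : ∀ n, q n ≤ 1) (n : Q) (a s : State G X) :
    blockDist lam n a s ≤ weightedDist lam q a s := by
  have h1 := blockDist_nonneg hlam n a s
  calc blockDist lam n a s ≤ (q n)⁻¹ * blockDist lam n a s :=
        le_mul_of_one_le_left h1 ((one_le_inv₀ (hq n)).2 (hq_le n))
    _ ≤ _ := Finset.single_le_sum (f := fun n => (q n)⁻¹ * blockDist lam n a s)
        (fun m _ => mul_nonneg (inv_nonneg.2 (hq m).le) (blockDist_nonneg hlam m a s))
        (Finset.mem_univ n)

theorem norm_le_of_blockDist_le {lam c : ℝ} (hlam : 0 < lam) {a s : State G X}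
    (h : ∀ n, blockDist lam n a s ≤ c) :
    (∀ d, ‖s.v d - a.v d‖ ≤ √(c / lam)) ∧ (∀ n, ‖s.y n - a.y n‖ ≤ √(c / lam)) ∧
      ∀ n, ‖s.x n - a.x n‖ ≤ √c := by
  have hsum : ∀ n, 0 ≤ ∑ d : G.Dart with d.fst = n, ‖s.v d - a.v d‖ ^ 2 := fun n => by positivity
  have hdual : ∀ n, ∑ d : G.Dart with d.fst = n, ‖s.v d - a.v d‖ ^ 2 + ‖s.y n - a.y n‖ ^ 2
      ≤ c / lam := fun n => by
    rw [le_div_iff₀' hlam]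
    exact (le_add_of_nonneg_right (sq_nonneg _)).trans (h n)
  refine ⟨fun d => Real.le_sqrt_of_sq_le ?_, fun n => Real.le_sqrt_of_sq_le ?_,
    fun n => Real.le_sqrt_of_sq_le ?_⟩
  · have h1 := Finset.single_le_sum (f := fun e : G.Dart => ‖s.v e - a.v e‖ ^ 2)
      (s := Finset.univ.filter fun e : G.Dart => e.fst = d.fst)
      (fun e _ => sq_nonneg _) (Finset.mem_filter.2 ⟨Finset.mem_univ d, rfl⟩)
    exact (h1.trans (le_add_of_nonneg_right (sq_nonneg _))).trans (hdual d.fst)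
  · exact (le_add_of_nonneg_left (hsum n)).trans (hdual n)
  · have h1 : 0 ≤ lam * (∑ d : G.Dart with d.fst = n, ‖s.v d - a.v d‖ ^ 2
        + ‖s.y n - a.y n‖ ^ 2) := by positivity
    exact (le_add_of_nonneg_left h1).trans (h n)

theorem weightedDist_self (lam : ℝ) (q : Q → ℝ) (a : State G X) : weightedDist lam q a a = 0 := by
  simp [weightedDist, blockDist]

theorem eq_of_weightedDist_eq_zero {lam : ℝ} (hlam : 0 < lam) {q : Q → ℝ} (hq : ∀ n, 0 < q n)
    (hq_le : ∀ n, q n ≤ 1) {a s : State G X} (h : weightedDist lam q a s = 0) : a = s := by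
  obtain ⟨hv, hy, hx⟩ := norm_le_of_blockDist_le hlam
    fun n => (blockDist_le_weightedDist hlam hq hq_le n a s).trans h.le
  simp only [zero_div, Real.sqrt_zero, norm_le_zero_iff, sub_eq_zero] at hv hy hx
  exact State.ext (funext fun d => (hv d).symm) (funext fun n => (hy n).symm)
    (funext fun n => (hx n).symm)

theorem isCompact_weightedDist_le [ProperSpace X] {lam : ℝ} (hlam : 0 < lam) {q : Q → ℝ}
    (hq : ∀ n, 0 < q n) (hq_le : ∀ n, q n ≤ 1) (a : State G X) (c : ℝ) :
    IsCompact {s | weightedDist lam q a s ≤ c} := by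
  have hclosed : IsClosed {s | weightedDist lam q a s ≤ c} :=
    isClosed_le (continuous_finsetSum _ fun n _ =>
      continuous_const.mul (continuous_blockDist_right lam n a)) continuous_const
  refine (State.homeomorphProd.isCompact_preimage.2 (isCompact_closedBall
    (State.homeomorphProd a) (√(c / lam) + √c))).of_isClosed_subset hclosed fun s hs => ?_
  obtain ⟨hv, hy, hx⟩ := norm_le_of_blockDist_le hlam
    fun n => (blockDist_le_weightedDist hlam hq hq_le n a s).trans hs
  have h1 := Real.sqrt_nonneg c
  have h2 := Real.sqrt_nonneg (c / lam)
  have h3 : 0 ≤ √(c / lam) + √c := add_nonneg h2 h1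
  change dist (State.homeomorphProd s) (State.homeomorphProd a) ≤ _
  refine max_le ((dist_pi_le_iff h3).2 fun d => ?_)
    (max_le ((dist_pi_le_iff h3).2 fun n => ?_) ((dist_pi_le_iff h3).2 fun n => ?_))
  · rw [dist_eq_norm]
    exact (hv d).trans (le_add_of_nonneg_right h1)
  · rw [dist_eq_norm]
    exact (hy n).trans (le_add_of_nonneg_right h1)
  · rw [dist_eq_norm]
    exact (hx n).trans (le_add_of_nonneg_left h2)

theorem continuous_dualSum (n : Q) : Continuous fun s : State G X => dualSum s n :=
  (continuous_finsetSum _ fun d _ => State.continuous_v d).add (State.continuous_y n)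

variable [InnerProductSpace ℝ X] [FiniteDimensional ℝ X] {f : Q → X → ℝ} {g : Q → X → EReal}
  {β γ lam : ℝ}

theorem continuous_localValue (hf : ∀ n, Continuous (grad (f n))) (n : Q) :
    Continuous fun s : State G X => localValue f γ lam s n := by
  simp only [localValue_eq]
  exact (continuous_gradStep hf n).sub ((continuous_dualSum n).const_smul lam)

theorem continuous_newV (hf : ∀ n, Continuous (grad (f n))) (d : G.Dart) :
    Continuous fun s : State G X => newV f γ lam s d :=
  (((continuous_localValue hf _).sub (continuous_localValue hf _)).const_smul _).add
    (((State.continuous_v d).sub (State.continuous_v d.symm)).const_smul _)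

theorem continuous_newY (hf : ∀ n, Continuous (grad (f n))) (hg : ∀ n, IsGammaZero (g n))
    (hγ : 0 < γ) (hlam : 0 < lam) (n : Q) :
    Continuous fun s : State G X => newY f g γ lam s n := by
  simp only [newY_eq]
  have h := (continuous_localValue (G := G) (γ := γ) (lam := lam) hf n).add (State.continuous_y n)
  exact h.sub (((hg n).const_mul (div_pos hγ hlam)).continuous_prox.comp h)

theorem continuous_fullStep (hf : ∀ n, Continuous (grad (f n))) (hg : ∀ n, IsGammaZero (g n))
    (hγ : 0 < γ) (hlam : 0 < lam) :
    Continuous (fullStep f g γ lam : State G X → State G X) :=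
  State.continuous_mk (continuous_newV hf) (continuous_newY hf hg hγ hlam) fun n =>
    ((continuous_gradStep hf n).sub ((continuous_finsetSum _ fun d _ =>
      continuous_newV hf d).const_smul lam)).sub
        ((continuous_newY hf hg hγ hlam n).const_smul lam)

theorem continuous_step (hf : ∀ n, Continuous (grad (f n))) (hg : ∀ n, IsGammaZero (g n))
    (hγ : 0 < γ) (hlam : 0 < lam) (B : Finset Q) :
    Continuous (step f g γ lam B : State G X → State G X) := by
  have h := continuous_fullStep (G := G) hf hg hγ hlam
  refine State.continuous_mk (fun d => ?_) (fun n => ?_) fun n => ?_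
  · split_ifs
    · exact continuous_newV hf d
    · exact State.continuous_v d
  · split_ifs
    · exact continuous_newY hf hg hγ hlam n
    · exact State.continuous_y n
  · split_ifs
    · exact (State.continuous_x n).comp h
    · exact State.continuous_x n

theorem continuous_blockGap (hf : ∀ n, Continuous (grad (f n))) (hg : ∀ n, IsGammaZero (g n))
    (hγ : 0 < γ) (hlam : 0 < lam) (n : Q) (a : State G X) :
    Continuous fun s => blockGap f g β γ lam n a s := by
  have h1 : Continuous fun s : State G X => grad (f n) (s.x n) :=
    (hf n).comp (State.continuous_x n)
  have h2 : Continuous fun s : State G X => dualSum s n := continuous_dualSum n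
  have h3 : Continuous fun s : State G X => dualSum (fullStep f g γ lam s) n :=
    h2.comp (continuous_fullStep hf hg hγ hlam)
  have h4 := fun d : G.Dart => (continuous_newV (f := f) (γ := γ) (lam := lam) hf d)
  have h5 := continuous_newY (G := G) hf hg hγ hlam n
  have h6 := State.continuous_v (G := G) (X := X)
  have h7 := State.continuous_y (G := G) (X := X)
  unfold blockGap
  fun_prop

end StateTopology

/-! ### Mean effect of a random step -/

section Convergence

variable {X : Type*} [NormedAddCommGroup X] [InnerProductSpace ℝ X] [FiniteDimensional ℝ X]
  {Q : Type*} [Fintype Q] [DecidableEq Q] {G : SimpleGraph Q} [DecidableRel G.Adj]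
  {f : Q → X → ℝ} {g : Q → X → EReal} {β γ lam : ℝ}

theorem iterates_eq_orbit (u₀ : State G X) (B : ℕ → Finset Q) (k : ℕ) :
    iterates f g γ lam u₀ B k = orbit (step f g γ lam) u₀ B k := by
  induction k with
  | zero => rfl
  | succ k ih => rw [iterates, orbit, ih]

theorem blockDist_step (B : Finset Q) (n : Q) (a s : State G X) :
    blockDist lam n a (step f g γ lam B s) =
      if n ∈ B then blockDist lam n a (fullStep f g γ lam s) else blockDist lam n a s := by
  have h : ∀ d ∈ Finset.univ.filter fun d : G.Dart => d.fst = n, (step f g γ lam B s).v d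
      = if n ∈ B then newV f γ lam s d else s.v d := fun d hd => by
    rw [← (Finset.mem_filter.1 hd).2]
    rfl
  rw [blockDist, Finset.sum_congr rfl fun d hd => by rw [h d hd]]
  simp only [step]
  split_ifs <;> rfl

/-- Block `n` makes its full move with probability `q n` and otherwise stays; the weight `(q n)⁻¹`
cancels this probability. -/
theorem sum_mul_weightedDist_step {p : Finset Q → ℝ} (hp : ∑ B, p B = 1) {q : Q → ℝ}
    (hq : ∀ n, q n = ∑ B with n ∈ B, p B) (hq_ne : ∀ n, q n ≠ 0) (a s : State G X) :
    ∑ B, p B * weightedDist lam q a (step f g γ lam B s) = weightedDist lam q a s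
      + (∑ n, blockDist lam n a (fullStep f g γ lam s) - ∑ n, blockDist lam n a s) := by
  have h : ∀ n, ∑ B, p B * blockDist lam n a (step f g γ lam B s) = blockDist lam n a s
      + q n * (blockDist lam n a (fullStep f g γ lam s) - blockDist lam n a s) := by
    intro n
    have h1 : ∀ B, p B * blockDist lam n a (step f g γ lam B s) = p B * blockDist lam n a s
        + (if n ∈ B then p B else 0)
          * (blockDist lam n a (fullStep f g γ lam s) - blockDist lam n a s) := by
      intro B
      rw [blockDist_step]
      split_ifs <;> ring
    rw [Finset.sum_congr rfl fun B _ => h1 B, Finset.sum_add_distrib, ← Finset.sum_mul,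
      ← Finset.sum_mul, hp, one_mul, ← Finset.sum_filter, ← hq]
  simp only [weightedDist, Finset.mul_sum]
  rw [Finset.sum_comm, ← Finset.sum_sub_distrib, ← Finset.sum_add_distrib]
  refine Finset.sum_congr rfl fun n _ => ?_
  have h2 : ∑ B, p B * ((q n)⁻¹ * blockDist lam n a (step f g γ lam B s))
      = (q n)⁻¹ * ∑ B, p B * blockDist lam n a (step f g γ lam B s) := by
    rw [Finset.mul_sum]
    exact Finset.sum_congr rfl fun B _ => mul_left_comm _ _ _
  rw [h2, h, mul_add, inv_mul_cancel_left₀ (hq_ne n)]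

end Convergence

end DASPDFP

/-- `ζ k` is the random set of agents active in the passage from iterate `k` to iterate `k + 1`. -/
theorem theorem5p2
    {X : Type*} [NormedAddCommGroup X] [InnerProductSpace ℝ X] [FiniteDimensional ℝ X]
    {Q : Type*} [Fintype Q] [DecidableEq Q] (hQ : 1 < Fintype.card Q)
    (G : SimpleGraph Q) [DecidableRel G.Adj] (hG : G.Connected)
    (f : Q → X → ℝ) (g : Q → X → EReal) (β γ lam : ℝ)
    (hβ : 0 < β)
    (hf_convex : ∀ n, ConvexOn ℝ Set.univ (f n))
    (hf_diff : ∀ n, Differentiable ℝ (f n))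
    (hf_lip : ∀ n x z, ‖DASPDFP.grad (f n) x - DASPDFP.grad (f n) z‖ ≤ 1 / β * ‖x - z‖)
    (hg : ∀ n, DASPDFP.IsGammaZero (g n))
    (hmin : ∃ x, DASPDFP.IsSolution f g x)
    (hri : (⋂ n, intrinsicInterior ℝ (DASPDFP.effDom (g n))).Nonempty)
    (hγ_pos : 0 < γ) (hγ_lt : γ < 2 * β)
    (hlam_pos : 0 < lam)
    (hlam_le : lam ≤ 1 / (DASPDFP.lambdaMax (DASPDFP.edgeGram G X) + 1))
    {Ω : Type*} [MeasurableSpace Ω] (P : Measure Ω) [IsProbabilityMeasure P]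
    (ζ : ℕ → Ω → Finset Q)
    (hζ_meas : ∀ k, Measurable (ζ k))
    (hζ_indep : iIndepFun ζ P)
    (hζ_ident : ∀ k, IdentDistrib (ζ k) (ζ 0) P P)
    (hζ_cover : (⋃ B ∈ {B : Finset Q | 0 < P {ω | ζ 0 ω = B}}, (B : Set Q)) = Set.univ)
    (u₀ : DASPDFP.State G X) :
    ∀ᵐ ω ∂P, ∃ xstar : X, DASPDFP.IsSolution f g xstar ∧
      ∀ n : Q, Filter.Tendsto
        (fun k => (DASPDFP.iterates f g γ lam u₀ (fun j => ζ j ω) k).x n)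
        Filter.atTop (nhds xstar) := by
  have : ProperSpace X := FiniteDimensional.proper ℝ X
  have : SecondCountableTopology (DASPDFP.State G X) :=
    DASPDFP.State.isInducing_equivProd.secondCountableTopology
  have hf_cont : ∀ n, Continuous (DASPDFP.grad (f n)) := fun n => DASPDFP.continuous_grad (hf_lip n)
  let p : Finset Q → ℝ := fun B => P.real {ω | ζ 0 ω = B}
  have hp_nonneg : ∀ B, 0 ≤ p B := fun B => measureReal_nonneg
  have hp : ∑ B, p B = 1 := by
    have h := sum_measureReal_preimage_singleton (μ := P) (f := ζ 0) Finset.univ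
      fun B _ => hζ_meas 0 (measurableSet_singleton B)
    simpa [p] using! h
  have hcover : ∀ n, ∃ B, n ∈ B ∧ 0 < p B := fun n => by
    have hn : n ∈ ⋃ B ∈ {B : Finset Q | 0 < P {ω | ζ 0 ω = B}}, (B : Set Q) :=
      hζ_cover ▸ Set.mem_univ n
    obtain ⟨B, hB, hnB⟩ := Set.mem_iUnion₂.1 hn
    exact ⟨B, hnB, ENNReal.toReal_pos (ne_of_gt hB) (measure_ne_top P _)⟩
  let q : Q → ℝ := fun n => ∑ B with n ∈ B, p B
  have hq : ∀ n, 0 < q n := fun n => by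
    obtain ⟨B, hnB, hB⟩ := hcover n
    exact hB.trans_le (Finset.single_le_sum (f := p) (fun B _ => hp_nonneg B)
      (Finset.mem_filter.2 ⟨Finset.mem_univ B, hnB⟩))
  have hq_le : ∀ n, q n ≤ 1 := fun n =>
    (Finset.sum_le_sum_of_subset_of_nonneg (Finset.filter_subset _ _)
      fun B _ _ => hp_nonneg B).trans hp.le
  obtain ⟨a₀, ha₀⟩ := DASPDFP.exists_fullStep_eq hG hγ_pos hlam_pos hf_diff hf_lip hg hmin hri
  have hgap_nonneg : ∀ n (a s : DASPDFP.State G X), 0 ≤ DASPDFP.blockGap f g β γ lam n a s :=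
    DASPDFP.blockGap_nonneg hQ hG hγ_pos hγ_lt hlam_pos hlam_le
  have hdec : ∀ a : DASPDFP.State G X, DASPDFP.fullStep f g γ lam a = a → ∀ s,
      ∑ B, p B * DASPDFP.weightedDist lam q a (DASPDFP.step f g γ lam B s)
        ≤ DASPDFP.weightedDist lam q a s - ∑ n, DASPDFP.blockGap f g β γ lam n a s := by
    intro a ha s
    rw [DASPDFP.sum_mul_weightedDist_step hp (fun _ => rfl) fun n => (hq n).ne']
    have := DASPDFP.sum_blockDist_fullStep_le hβ hγ_pos hlam_pos hf_convex hf_diff hf_lip hg ha s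
    linarith
  have hconv := DASPDFP.ae_exists_tendsto_orbit (T := DASPDFP.step f g γ lam)
    (F := {a : DASPDFP.State G X | DASPDFP.fullStep f g γ lam a = a})
    (V := DASPDFP.weightedDist lam q)
    (φ := fun s => ∑ n, DASPDFP.blockGap f g β γ lam n a₀ s) hζ_meas hζ_indep hζ_ident
    (DASPDFP.continuous_step hf_cont hg hγ_pos hlam_pos)
    (fun s => continuous_finsetSum _ fun n _ =>
      continuous_const.mul (DASPDFP.continuous_blockDist_left lam n s))
    (fun a => continuous_finsetSum _ fun n _ =>
      continuous_const.mul (DASPDFP.continuous_blockDist_right lam n a))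
    (fun a s => Finset.sum_nonneg fun n _ =>
      mul_nonneg (inv_nonneg.2 (hq n).le) (DASPDFP.blockDist_nonneg hlam_pos n a s))
    (DASPDFP.weightedDist_self lam q)
    (fun a s h => DASPDFP.eq_of_weightedDist_eq_zero hlam_pos hq hq_le h)
    (DASPDFP.isCompact_weightedDist_le hlam_pos hq hq_le)
    (fun a ha s => (hdec a ha s).trans
      (sub_le_self _ (Finset.sum_nonneg fun n _ => hgap_nonneg n a s)))
    ha₀
    (continuous_finsetSum _ fun n _ =>
      DASPDFP.continuous_blockGap hf_cont hg hγ_pos hlam_pos n a₀)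
    (fun s => Finset.sum_nonneg fun n _ => hgap_nonneg n a₀ s)
    (hdec a₀ ha₀)
    -- By the covering hypothesis every agent lies in some active set of positive probability, and
    -- the gap vanishes after that update as well.
    (fun s hs hs' => by
      have hzero : ∀ s, ∑ n, DASPDFP.blockGap f g β γ lam n a₀ s = 0 →
          ∀ n, DASPDFP.blockGap f g β γ lam n a₀ s = 0 := fun s h n =>
        (Finset.sum_eq_zero_iff_of_nonneg fun n _ => hgap_nonneg n a₀ s).1 h n (Finset.mem_univ n)
      refine DASPDFP.fullStep_eq_of_blockGap_eq_zero hQ hG hγ_pos hγ_lt hlam_pos hlam_le ha₀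
        (hzero s hs) fun n => ?_
      obtain ⟨B, hnB, hB⟩ := hcover n
      exact ⟨B, hnB, hzero _ (hs' B hB) n⟩) u₀
  filter_upwards [hconv] with ω ⟨z, hz, hlim⟩
  obtain ⟨xs, hxs, hz_eq⟩ :=
    DASPDFP.exists_isSolution_of_fullStep_eq hG hγ_pos hlam_pos hf_convex hf_diff hg hz
  refine ⟨xs, hxs, fun n => ?_⟩
  simp only [DASPDFP.iterates_eq_orbit]
  rw [← hz_eq n]
  exact ((DASPDFP.State.continuous_x n).tendsto z).comp hlim
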